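/- Let $h(x)=-x\log_2 x-(1-x)\log_2(1-x)$ and let $0<p<\tfrac12$. Put $$g_p(\sigma)=(1-2\sigma)\,h\!\left(\frac{p-\sigma}{1-2\sigma}\right)+2\sigma .$$ Then $g_p$ is a bijection $[0,p]\to[2p,h(p)]$; let $g_p^{-1}$ be its inverse. Let $p_A,p_B\in[0,1]$ be such that $h(p_A)\in[2p,h(p)]$ and $2g_p^{-1}(h(p_A))\le\tfrac12$, and let $$R(p,p_A,p_B)=h(p_B)-h\bigl(2g_p^{-1}(h(p_A))\bigr).$$ *Setting.* A string commitment protocol for a finite message set $\mathcal M$ consists of a commit phase (finitely many rounds of noiseless two-way classical communication, and one use, at any point, of a noisy channel from Alice to Bob on $\{0,1\}^n$) and a reveal phase (noiseless rounds, after which Bob outputs a message $\hat M$ and a flag $F$). Its parameters are * $\delta_c=\max_m\bigl(1-\Pr[\hat M=m\wedge F=\mathrm{acc}]\bigr)$, for honest parties and the honest channel; * $\delta_h$, the supremum over the strategies and the admissible channels of a dishonest Bob, and over $m\ne m'$, of the trace distance of the states that describe all of Bob's information after the commit phase when Alice commits to $m$, respectively to $m'$; * $\delta_b$, the supremum over the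 strategies and the admissible channels of a dishonest Alice of the probability that two copies of the honest Bob's reveal phase, started from the same commit phase and played against two reveal strategies of Alice, accept two different messages. A rate $R$ is *achievable* for a sequence of channel models if for every $R'$ with $0\le R'<R$ there are protocols $\Phi_n$ with message sets $\mathcal M_n$ such that $\delta_c,\delta_h,\delta_b\to0$ and $\frac1n\log_2|\mathcal M_n|\to R'$. For $\theta=(p,\varepsilon_A,l_A,\varepsilon_B,l_B)$ with $\varepsilon_A,l_A,\varepsilon_B,l_B\ge0$, the $(n,\theta)$ *unstructured noisy channel* (UsNC) model has as honest channel the $n$-fold binary symmetric channel (BSC) with crossover probability $p$. A dishonest Alice may use any channel $W^A$ from any set to $\{0,1\}^n$ with $H_{\min}^{\varepsilon_A}(Z)_{W^A(x)}\ge l_A$ for all inputs $x$. A dishonest Bob may use any classical-quantum channel $W^B$ from $\{0,1\}^n$ to a finite-dimensional system $B$ with $H_{\min}^{\varepsilon_B}(X|B)_{W^B\times U}\ge l_B$, where $U$ is the uniform distribution on $\{0,1\}^n$. The smooth min-entropies are taken with respect to the generalized trace distance on subnormalized states. *Claim.* 1. If the honest channel, the channel of a dishonest Alice and the channel of a dishonest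 Bob are the $n$-fold BSCs with crossover probabilities $p$, $p_A$ and $p_B$, then the rate $R(p,p_A,p_B)$ is achievable. 2. More precisely, there are parameters $\theta_n=(p,\varepsilon_{A,n},l_{A,n},\varepsilon_{B,n},l_{B,n})$ with $\varepsilon_{A,n},\varepsilon_{B,n}\to0$, $l_{A,n}/n\to h(p_A)$ and $l_{B,n}/n\to h(p_B)$ such that, for every $n$, the $n$-fold BSCs with crossover probabilities $p_A$ and $p_B$ are admissible channels of a dishonest Alice and a dishonest Bob in the $(n,\theta_n)$-UsNC model, and $R(p,p_A,p_B)$ is achievable for the sequence of these UsNC models. 3. For $p_A=p_B=p$ the rate is $R(p,p,p)=h(p)$. -/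

import Mathlib

open Filter Topology
open scoped ENNReal Matrix ComplexOrder

noncomputable section

namespace Commitment

/-! ### Scalar functions -/

/-- Binary entropy with base-two logarithm. -/
def h (x : ℝ) : ℝ := Real.binEntropy x / Real.log 2

/-- `g_p(σ) = (1 - 2σ) h((p - σ)/(1 - 2σ)) + 2σ`, used on `[0, p]`. -/
def g (p σ : ℝ) : ℝ := (1 - 2 * σ) * h ((p - σ) / (1 - 2 * σ)) + 2 * σ

/-- The inverse of `g_p : [0, p] → [2p, h(p)]`. -/
def gInv (p : ℝ) : ℝ → ℝ := Function.invFunOn (g p) (Set.Icc 0 p)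

/-- The rate `h(p_B) - h(2 g_p⁻¹(h(p_A)))`. -/
def rate (p pA pB : ℝ) : ℝ := h pB - h (2 * gInv p (h pA))

/-! ### Finite-dimensional quantum states and (smooth) min-entropies

Operators on the Hilbert space with orthonormal basis `ι` are the matrices `Matrix ι ι ℂ`;
the system `AB` has basis `α × β`. All entropies are in bits and take values in `EReal`,
so that every supremum and infimum below is a true one. -/

section Quantum

variable {ι α β : Type} [Fintype ι] [DecidableEq ι] [Fintype α] [DecidableEq α]
  [Fintype β] [DecidableEq β]

/-- Density operators. -/
def IsState (ρ : Matrix ι ι ℂ) : Prop := ρ.PosSemidef ∧ ρ.trace = 1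

/-- Subnormalized states. -/
def IsSubState (ρ : Matrix ι ι ℂ) : Prop := ρ.PosSemidef ∧ ρ.trace.re ≤ 1

/-- The trace norm: the sum of the singular values, that is, of the square roots of the
eigenvalues of `Aᴴ * A`. -/
def traceNorm (A : Matrix ι ι ℂ) : ℝ :=
  ∑ i, Real.sqrt ((Matrix.isHermitian_conjTranspose_mul_self A).eigenvalues i)

/-- Generalized trace distance. -/
def gtd (ρ σ : Matrix ι ι ℂ) : ℝ :=
  1 / 2 * traceNorm (ρ - σ) + 1 / 2 * ‖ρ.trace - σ.trace‖

/-- `D_∞(ρ ‖ σ) = inf {l : ρ ≤ 2 ^ l σ}`. -/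
def dMax (ρ σ : Matrix ι ι ℂ) : EReal :=
  ⨅ (l : ℝ) (_ : ((((2 : ℝ) ^ l : ℝ) : ℂ) • σ - ρ).PosSemidef), (l : EReal)

/-- Conditional min-entropy `H_min(A|B)_ρ`. -/
def condMinEntropy (ρ : Matrix (α × β) (α × β) ℂ) : EReal :=
  ⨆ (σ : Matrix β β ℂ) (_ : IsState σ), -dMax ρ (Matrix.kronecker (1 : Matrix α α ℂ) σ)

/-- Smooth conditional min-entropy `H_min^ε(A|B)_ρ`. -/
def smoothCondMinEntropy (ε : ℝ) (ρ : Matrix (α × β) (α × β) ℂ) : EReal :=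
  ⨆ (ρ' : Matrix (α × β) (α × β) ℂ) (_ : IsSubState ρ' ∧ gtd ρ' ρ ≤ ε), condMinEntropy ρ'

/-- The joint state `W × U`, with a uniform classical input `x`, of a cq channel `W`. -/
def uniformJoint (W : α → Matrix β β ℂ) : Matrix (α × β) (α × β) ℂ :=
  Matrix.of fun i j => if i.1 = j.1 then (Fintype.card α : ℂ)⁻¹ * W i.1 i.2 j.2 else 0

/-- Classical generalized trace distance. -/
def gtdClassical (P Q : α → ℝ) : ℝ :=
  1 / 2 * ∑ x, |P x - Q x| + 1 / 2 * |∑ x, (P x - Q x)|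

/-- Classical min-entropy `-log₂ max_x P(x)`, which is `⊤` for `P = 0`. -/
def minEntropy (P : α → ℝ) : EReal :=
  -⨅ (l : ℝ) (_ : ∀ x, P x ≤ (2 : ℝ) ^ l), (l : EReal)

/-- Smooth classical min-entropy; the smoothing ranges over subnormalized distributions. -/
def smoothMinEntropy (ε : ℝ) (P : α → ℝ) : EReal :=
  ⨆ (Q : α → ℝ) (_ : (∀ x, 0 ≤ Q x) ∧ ∑ x, Q x ≤ 1 ∧ gtdClassical Q P ≤ ε), minEntropy Q

end Quantum

/-- A quantum instrument on the system `ι` with classical outcomes in `O`, in Kraus form. -/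
structure Instrument (ι O : Type) [Fintype ι] [DecidableEq ι] [Fintype O] where
  κ : Type
  [fintypeκ : Fintype κ]
  K : O → κ → Matrix ι ι ℂ
  complete : ∑ o, ∑ k, (K o k)ᴴ * K o k = 1

attribute [instance] Instrument.fintypeκ

/-- The unnormalized state after outcome `o`. -/
def Instrument.apply {ι O : Type} [Fintype ι] [DecidableEq ι] [Fintype O]
    (I : Instrument ι O) (o : O) (ρ : Matrix ι ι ℂ) : Matrix ι ι ℂ :=
  ∑ k, I.K o k * ρ * (I.K o k)ᴴ

/-! ### Channels -/

/-- Binary words of length `n`. -/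
abbrev Word (n : ℕ) : Type := Fin n → ZMod 2

/-- The `n`-fold binary symmetric channel with crossover probability `p`. -/
def bsc (n : ℕ) (p : unitInterval) (x : Word n) : PMF (Word n) :=
  PMF.ofFintype (fun z => ∏ i, ENNReal.ofReal (if x i = z i then 1 - (p : ℝ) else p)) <| by
    have key : ∀ a : ZMod 2,
        ∑ b : ZMod 2, ENNReal.ofReal (if a = b then 1 - (p : ℝ) else p) = 1 := by
      intro a
      have h2 : ∑ b : ZMod 2, ENNReal.ofReal (if a = b then 1 - (p : ℝ) else p) =
          ENNReal.ofReal (1 - (p : ℝ)) + ENNReal.ofReal p := by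
        have h01 : (0 : ZMod 2) ≠ 1 := by decide
        have hs : ∀ f : ZMod 2 → ℝ≥0∞, ∑ b : ZMod 2, f b = f 0 + f 1 :=
          fun f => Fin.sum_univ_two f
        have ha : a = 0 ∨ a = 1 := by revert a; decide
        rw [hs]
        rcases ha with rfl | rfl
        · rw [if_pos rfl, if_neg h01]
        · rw [if_pos rfl, if_neg h01.symm, add_comm]
      rw [h2, ← ENNReal.ofReal_add (by linarith [p.2.2]) p.2.1]
      simp
    have h3 := Finset.prod_univ_sum (fun _ : Fin n => (Finset.univ : Finset (ZMod 2)))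
      (fun i b => ENNReal.ofReal (if x i = b then 1 - (p : ℝ) else p))
    rw [Fintype.piFinset_univ] at h3
    rw [← h3]
    simp [key]

/-- A channel of a dishonest Alice: an arbitrary input set, and an output in `{0,1}^n`. -/
structure AliceChannel (n : ℕ) where
  X : Type
  W : X → PMF (Word n)

/-- A channel of a dishonest Bob: a classical-quantum channel from `{0,1}^n` to an arbitrary
finite-dimensional quantum system. -/
structure BobChannel (n : ℕ) where
  B : Type
  [fintypeB : Fintype B]
  [decEqB : DecidableEq B]
  W : Word n → Matrix B B ℂ
  isState : ∀ x, IsState (W x)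

attribute [instance] BobChannel.fintypeB BobChannel.decEqB

/-- The `n`-fold BSC as a channel of a dishonest Alice. -/
def bscAlice (n : ℕ) (p : unitInterval) : AliceChannel n where
  X := Word n
  W := bsc n p

/-- The `n`-fold BSC as a channel of a dishonest Bob: the output distribution is a diagonal
density matrix. -/
def bscBob (n : ℕ) (p : unitInterval) : BobChannel n where
  B := Word n
  W x := Matrix.diagonal fun z => ((bsc n p x z).toReal : ℂ)
  isState x := by
    classical
    refine ⟨Matrix.PosSemidef.diagonal fun z => ?_, ?_⟩
    · simp
    · rw [Matrix.trace_diagonal, ← Complex.ofReal_sum,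
        ← ENNReal.toReal_sum fun z _ => (bsc n p x).apply_ne_top z,
        ← tsum_fintype (L := SummationFilter.unconditional _), (bsc n p x).tsum_coe]
      simp

/-- A noisy-channel model: the channel between honest parties and the channels that a
dishonest Alice, respectively a dishonest Bob, can turn it into. -/
structure Model (n : ℕ) where
  honest : Word n → PMF (Word n)
  alice : Set (AliceChannel n)
  bob : Set (BobChannel n)

/-- The model in which the honest channel, Alice's channel and Bob's channel are the `n`-fold
BSCs with crossover probabilities `p`, `pA`, `pB`. -/
def bscModel (p pA pB : unitInterval) (n : ℕ) : Model n where
  honest := bsc n p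
  alice := {bscAlice n pA}
  bob := {bscBob n pB}

/-- Parameters `θ = (p, ε_A, l_A, ε_B, l_B)` of an unstructured noisy channel. -/
structure Params where
  p : unitInterval
  p_pos : 0 < (p : ℝ)
  p_lt : (p : ℝ) < 1 / 2
  εA : ℝ
  lA : ℝ
  εB : ℝ
  lB : ℝ
  εA_nonneg : 0 ≤ εA
  lA_nonneg : 0 ≤ lA
  εB_nonneg : 0 ≤ εB
  lB_nonneg : 0 ≤ lB

/-- The `(n, θ)` unstructured noisy channel model. -/
def usnc (n : ℕ) (θ : Params) : Model n where
  honest := bsc n θ.p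
  alice := {c | ∀ x, (θ.lA : EReal) ≤ smoothMinEntropy θ.εA fun z => (c.W x z).toReal}
  bob := {c | (θ.lB : EReal) ≤ smoothCondMinEntropy θ.εB (uniformJoint c.W)}

/-! ### Interactive protocols

In every round of noiseless communication Alice sends a symbol of a finite alphabet and then
Bob replies with one. A history is the list of the symbols sent by one party, the newest
first. A party is given by functions that map its private randomness and the symbols received
so far to its next symbol (its own earlier symbols are determined by these). -/

section Rounds

variable {T : Type}

/-- The symbols sent by an Alice with next-symbol function `a` during the rounds in which
Bob's replies were `bs`. -/
def aliceHist (a : List T → T) : List T → List T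
  | [] => []
  | _ :: bs => a bs :: aliceHist a bs

/-- Bob's replies after `k` further rounds that start from his replies `bs`, when Alice's
next-symbol function is `a` and Bob's is `b`. -/
def rounds (a b : List T → T) (bs : List T) : ℕ → List T
  | 0 => bs
  | k + 1 =>
    let cs := rounds a b bs k
    b (a cs :: aliceHist a cs) :: cs

end Rounds

/-- A string commitment protocol for messages in `M`. The commit phase has `pre` rounds of
noiseless communication, one use of the noisy channel (on a word of length `n`), and then
`post` rounds; the reveal phase has `reveal` rounds. -/
structure Protocol (n : ℕ) (M : Type) where
  /-- alphabet of the noiseless channel -/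
  T : Type
  [fintypeT : Fintype T]
  [decEqT : DecidableEq T]
  pre : ℕ
  post : ℕ
  reveal : ℕ
  /-- private randomness of Alice -/
  RA : Type
  [fintypeRA : Fintype RA]
  distA : PMF RA
  /-- private randomness of Bob in the commit phase (remembered in the reveal phase) -/
  RB : Type
  [fintypeRB : Fintype RB]
  distB : PMF RB
  /-- fresh private randomness of Bob in the reveal phase -/
  RV : Type
  [fintypeRV : Fintype RV]
  distV : PMF RV
  /-- Alice's next symbol in the commit phase -/
  aliceCommit : RA → M → List T → T
  /-- Alice's input to the noisy channel -/
  aliceInput : RA → M → List T → Word n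
  /-- Alice's next symbol in the reveal phase, given Bob's symbols of the commit phase and of
  the reveal phase -/
  aliceReveal : RA → M → List T → List T → T
  /-- Bob's next symbol before the use of the noisy channel -/
  bobPre : RB → List T → T
  /-- Bob's next symbol after the use of the noisy channel, which gave him a word; the list
  contains all of Alice's symbols of the commit phase so far -/
  bobPost : RB → Word n → List T → T
  /-- Bob's next symbol in the reveal phase, given Alice's symbols of the commit phase and of
  the reveal phase -/
  bobReveal : RB → RV → Word n → List T → List T → T
  /-- Bob's output: the revealed message and a flag, `true` for acceptance -/
  output : RB → RV → Word n → List T → List T → M × Bool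

attribute [instance] Protocol.fintypeT Protocol.decEqT Protocol.fintypeRA

namespace Protocol

variable {n : ℕ} {M : Type} (Φ : Protocol n M)

/-- The commit phase with honest Bob (randomness `rB`), and an Alice with next-symbol function
`a` who feeds the input `inp bs` to the channel `W`. The outcome is the list of Bob's symbols
and the output of the channel. -/
def commitRun {X : Type} (W : X → PMF (Word n)) (a : List Φ.T → Φ.T) (inp : List Φ.T → X)
    (rB : Φ.RB) : PMF (List Φ.T × Word n) :=
  let bs := rounds a (Φ.bobPre rB) [] Φ.pre
  (W (inp bs)).map fun z => (rounds a (Φ.bobPost rB z) bs Φ.post, z)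

/-- Bob's output after a reveal phase with honest Bob and an Alice with next-symbol function
`a`; here `as` is the list of Alice's symbols of the commit phase. -/
def revealRun (rB : Φ.RB) (rV : Φ.RV) (z : Word n) (as : List Φ.T) (a : List Φ.T → Φ.T) :
    M × Bool :=
  Φ.output rB rV z as (aliceHist a (rounds a (Φ.bobReveal rB rV z as) [] Φ.reveal))

/-- Bob's output when both parties are honest and the message `m` is committed. -/
def honestRun (W : Word n → PMF (Word n)) (m : M) : PMF (M × Bool) :=
  Φ.distA.bind fun rA =>
  Φ.distB.bind fun rB =>
  (Φ.commitRun W (Φ.aliceCommit rA m) (Φ.aliceInput rA m) rB).bind fun c =>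
  Φ.distV.map fun rV =>
    Φ.revealRun rB rV c.2 (aliceHist (Φ.aliceCommit rA m) c.1) (Φ.aliceReveal rA m c.1)

/-- The completeness parameter. -/
def deltaC (mod : Model n) : ℝ≥0∞ :=
  ⨆ m : M, 1 - Φ.honestRun mod.honest m (m, true)

/-- A strategy of a dishonest Alice with channel `c`: one system for the commit phase and two
for the reveal phase, which share the private randomness. -/
structure AliceStrategy (c : AliceChannel n) where
  S : Type
  dist : PMF S
  commit : S → List Φ.T → Φ.T
  input : S → List Φ.T → c.X
  reveal : Fin 2 → S → List Φ.T → List Φ.T → Φ.T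

/-- The outputs of two copies of the honest Bob's reveal phase that start from the same commit
phase, the first played against the dishonest Alice's strategy `0`, the second against `1`. -/
def bindingRun {c : AliceChannel n} (A : Φ.AliceStrategy c) :
    PMF ((M × Bool) × (M × Bool)) :=
  A.dist.bind fun s =>
  Φ.distB.bind fun rB =>
  (Φ.commitRun c.W (A.commit s) (A.input s) rB).bind fun t =>
  Φ.distV.bind fun r0 =>
  Φ.distV.map fun r1 =>
    let as := aliceHist (A.commit s) t.1
    (Φ.revealRun rB r0 t.2 as (A.reveal 0 s t.1), Φ.revealRun rB r1 t.2 as (A.reveal 1 s t.1))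

/-- The binding parameter. -/
def deltaB (mod : Model n) : ℝ≥0∞ :=
  ⨆ c ∈ mod.alice, ⨆ A : Φ.AliceStrategy c,
    (Φ.bindingRun A).toOuterMeasure {v | v.1.2 = true ∧ v.2.2 = true ∧ v.1.1 ≠ v.2.1}

/-- A strategy of a dishonest Bob with channel `c` in the commit phase. He has a quantum memory
`E`; in every round he applies an instrument, chosen by the symbols exchanged so far (first
Alice's, then his own), and sends the outcome. After the use of the noisy channel, he holds
`E` and the output `B` of his channel. -/
structure BobStrategy (c : BobChannel n) where
  E : Type
  [fintypeE : Fintype E]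
  [decEqE : DecidableEq E]
  init : Matrix E E ℂ
  init_isState : IsState init
  pre : List Φ.T → List Φ.T → Instrument E Φ.T
  post : List Φ.T → List Φ.T → Instrument (E × c.B) Φ.T

attribute [instance] BobStrategy.fintypeE BobStrategy.decEqE

variable {Φ} {c : BobChannel n} (S : Φ.BobStrategy c)

/-- The unnormalized state of Bob's memory after the rounds before the use of the noisy
channel, on the branch in which his replies are `bs`. -/
def BobStrategy.preState (a : List Φ.T → Φ.T) : List Φ.T → Matrix S.E S.E ℂ
  | [] => S.init
  | b :: bs => (S.pre (a bs :: aliceHist a bs) bs).apply b (BobStrategy.preState a bs)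

/-- The unnormalized state of Bob's registers in the rounds after the use of the noisy channel
with input `x`, on the branch in which his replies are `bs₀` before and the argument of type
`List` after the use of the channel. -/
def BobStrategy.postState (a : List Φ.T → Φ.T) (x : Word n) (bs₀ : List Φ.T) :
    List Φ.T → Matrix (S.E × c.B) (S.E × c.B) ℂ
  | [] => Matrix.kronecker (S.preState a bs₀) (c.W x)
  | b :: bs =>
    (S.post (a (bs ++ bs₀) :: aliceHist a (bs ++ bs₀)) (bs ++ bs₀)).apply b
      (BobStrategy.postState a x bs₀ bs)

/-- The state of all of Bob's information at the end of the commit phase when the honest Alice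
commits to `m`: the classical symbols sent by Alice, Bob's symbols before and after the use of
the noisy channel, and Bob's quantum registers. -/
def BobStrategy.view (m : M) :
    Matrix
      ((S.E × c.B) × (List.Vector Φ.T (Φ.pre + Φ.post) ×
        List.Vector Φ.T Φ.pre × List.Vector Φ.T Φ.post))
      ((S.E × c.B) × (List.Vector Φ.T (Φ.pre + Φ.post) ×
        List.Vector Φ.T Φ.pre × List.Vector Φ.T Φ.post)) ℂ :=
  Matrix.blockDiagonal fun t =>
    ∑ rA : Φ.RA,
      if aliceHist (Φ.aliceCommit rA m) (t.2.2.toList ++ t.2.1.toList) = t.1.toList then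
        ((Φ.distA rA).toReal : ℂ) •
          S.postState (Φ.aliceCommit rA m) (Φ.aliceInput rA m t.2.1.toList) t.2.1.toList
            t.2.2.toList
      else 0

variable (Φ)

/-- The hiding parameter. -/
def deltaH (mod : Model n) : ℝ≥0∞ :=
  ⨆ c ∈ mod.bob, ⨆ S : Φ.BobStrategy c, ⨆ (m : M) (m' : M) (_ : m ≠ m'),
    ENNReal.ofReal (gtd (S.view m) (S.view m'))

end Protocol

/-- The rate `R` is achievable for a sequence of models: every rate in `[0, R)` is the limit of
the rates of a sequence of protocols whose completeness, hiding and binding parameters vanish.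
The message set of the `n`-th protocol has `K n ≥ 1` elements. -/
def Achievable (mod : ∀ n, Model n) (R : ℝ) : Prop :=
  ∀ R' : ℝ, 0 ≤ R' → R' < R →
    ∃ (K : ℕ → ℕ) (Φ : ∀ n, Protocol n (Fin (K n))),
      (∀ n, 0 < K n) ∧
      Tendsto (fun n => (Φ n).deltaC (mod n)) atTop (𝓝 0) ∧
      Tendsto (fun n => (Φ n).deltaH (mod n)) atTop (𝓝 0) ∧
      Tendsto (fun n => (Φ n).deltaB (mod n)) atTop (𝓝 0) ∧
      Tendsto (fun n : ℕ => Real.logb 2 (K n) / n) atTop (𝓝 R')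

end Commitment

end

/-! Alice sends a uniform word `x` through the channel and publishes its colour `C x`, a uniformly
random function `F` and the masked message `F x + m`. To reveal she sends `x`, and Bob checks the
colour and that `x` lies within distance `(p + δ) n` of the word `z` he received. The colouring is
chosen so that distinct words of one colour are more than `2 σ n` apart; greedy colouring needs at
most `2 ^ (n h(2σ))` colours (`exists_separating_coloring`).

Completeness is a Chernoff bound.

Binding: to open two messages, Alice needs two words of one colour whose balls of radius `(p + δ) n`
both contain `z`. Her revealed words cannot depend on `z`, and `z` has smooth min-entropy about `n
h(pA)`, so it suffices that the intersection of the balls has exponentially fewer than `2 ^ (n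
h(pA))` words. A Bhattacharyya argument (`card_inter_balls_le`) bounds its size, at `δ = 0`, by `exp
(n * tilt p s σ)` for every admissible `s`. For `σ ≤ p` the infimum over `s` is governed by `g p σ *
log 2`, and `g p` is strictly decreasing, so every `σ` above `σ₀ = gInv p (h pA)` works
(`exists_tilt_lt`), with room left for `δ`.

Hiding: the colour and the masked message take about `n (h(2σ) + R)` bits, while a dishonest Bob has
uncertainty about `n h(pB)` on `x`. The leftover hash lemma against quantum side information
(`sum_traceNorm_le`, `deltaH_hashProtocol_le`) makes his views nearly equal when `h(2σ) + R <
h(pB)`. Letting `σ` decrease to `σ₀` gives the rate.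

This proves the claim for UsNC models. Truncating atypical outputs shows that BSCs are admissible
there (`exists_typical` and the two smoothing lemmas), so the BSC model has fewer attacks and
inherits the rate. -/

noncomputable section

namespace Commitment

/-! ### The functions `h` and `g` -/

lemma log_two_pos : 0 < Real.log 2 := Real.log_pos one_lt_two

lemma binEntropy_eq_neg (q : ℝ) :
    Real.binEntropy q = -q * Real.log q - (1 - q) * Real.log (1 - q) := by
  simp only [Real.binEntropy, Real.log_inv]; ring

lemma h_mul_log_two (x : ℝ) : h x * Real.log 2 = Real.binEntropy x :=
  div_mul_cancel₀ _ log_two_pos.ne'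

lemma h_zero : h 0 = 0 := by simp [h]

lemma h_nonneg {x : ℝ} (h0 : 0 ≤ x) (h1 : x ≤ 1) : 0 ≤ h x :=
  div_nonneg (Real.binEntropy_nonneg h0 h1) log_two_pos.le

lemma h_le_one (x : ℝ) : h x ≤ 1 :=
  div_le_one_of_le₀ Real.binEntropy_le_log_two log_two_pos.le

lemma h_half : h (1 / 2) = 1 := by
  have : Real.binEntropy (1 / 2) = Real.log 2 := by
    rw [one_div]; exact Real.binEntropy_two_inv
  rw [h, this, div_self log_two_pos.ne']

lemma continuous_h : Continuous h := Real.binEntropy_continuous.div_const _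

/-- This is `log t ≤ t - 1` at `t = s / q`, the termwise form of Gibbs' inequality. -/
lemma mul_log_sub_log_le {q s : ℝ} (hq : 0 ≤ q) (hs : 0 < s) :
    q * (Real.log s - Real.log q) ≤ s - q := by
  rcases hq.eq_or_lt with rfl | hq
  · simpa using hs.le
  · rw [← Real.log_div hs.ne' hq.ne']
    calc q * Real.log (s / q) ≤ q * (s / q - 1) :=
          mul_le_mul_of_nonneg_left (Real.log_le_sub_one_of_pos (by positivity)) hq.le
      _ = s - q := by field_simp

/-- Gibbs' inequality for two binary distributions. -/
lemma binEntropy_le_crossEntropy {q s : ℝ} (hq0 : 0 ≤ q) (hq1 : q ≤ 1) (hs0 : 0 < s)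
    (hs1 : s < 1) :
    Real.binEntropy q ≤ -q * Real.log s - (1 - q) * Real.log (1 - s) := by
  rw [binEntropy_eq_neg]
  have h1 := mul_log_sub_log_le hq0 hs0
  have h2 := mul_log_sub_log_le (sub_nonneg.2 hq1) (sub_pos.2 hs1)
  linarith

/-- A function that is affine in `σ`; the minimum over `s` is `g p σ * log 2`. -/
def tilt (p s σ : ℝ) : ℝ :=
  2 * σ * Real.log 2 - (p - σ) * Real.log s - (1 - p - σ) * Real.log (1 - s)

/-- The optimal `s` is the argument of `h` inside `g`: there cross entropy and entropy coincide. -/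
lemma g_mul_log_two (p : ℝ) {σ : ℝ} (hσ : 1 - 2 * σ ≠ 0) :
    g p σ * Real.log 2 = tilt p ((p - σ) / (1 - 2 * σ)) σ := by
  have key : g p σ * Real.log 2
      = (1 - 2 * σ) * Real.binEntropy ((p - σ) / (1 - 2 * σ)) + 2 * σ * Real.log 2 := by
    rw [← h_mul_log_two, g]; ring
  rw [key, binEntropy_eq_neg, tilt]
  have h1 : (1 - 2 * σ) * ((p - σ) / (1 - 2 * σ)) = p - σ := mul_div_cancel₀ _ hσ
  linear_combination (-Real.log ((p - σ) / (1 - 2 * σ))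
    + Real.log (1 - (p - σ) / (1 - 2 * σ))) * h1

lemma g_mul_log_two_le {p s σ : ℝ} (hσp : σ ≤ p) (hp : p < 1 / 2)
    (hs0 : 0 < s) (hs1 : s < 1) : g p σ * Real.log 2 ≤ tilt p s σ := by
  have hσ : 0 < 1 - 2 * σ := by linarith
  have key : g p σ * Real.log 2
      = (1 - 2 * σ) * Real.binEntropy ((p - σ) / (1 - 2 * σ)) + 2 * σ * Real.log 2 := by
    rw [← h_mul_log_two, g]; ring
  have hq0 : 0 ≤ (p - σ) / (1 - 2 * σ) := div_nonneg (by linarith) hσ.le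
  have hq1 : (p - σ) / (1 - 2 * σ) ≤ 1 := (div_le_one hσ).2 (by linarith)
  have h1 := mul_le_mul_of_nonneg_left (binEntropy_le_crossEntropy hq0 hq1 hs0 hs1) hσ.le
  have h2 : (1 - 2 * σ) * ((p - σ) / (1 - 2 * σ)) = p - σ := mul_div_cancel₀ _ hσ.ne'
  rw [key, tilt]
  refine (add_le_add_left h1 _).trans (le_of_eq ?_)
  linear_combination (-Real.log s + Real.log (1 - s)) * h2

/-- The slope of the affine function is the logarithm of the squared Bhattacharyya coefficient of
one bit; it is negative for `s < 1/2`. -/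
lemma tilt_sub (p : ℝ) {s : ℝ} (hs0 : 0 < s) (hs1 : s < 1) (σ τ : ℝ) :
    tilt p s τ - tilt p s σ = (τ - σ) * Real.log (4 * (s * (1 - s))) := by
  have h1 : (0 : ℝ) < 1 - s := by linarith
  have h4 : Real.log 4 = 2 * Real.log 2 := by
    rw [show (4 : ℝ) = 2 ^ 2 by norm_num, Real.log_pow]; norm_num
  rw [Real.log_mul (by norm_num) (by positivity), Real.log_mul hs0.ne' h1.ne', h4, tilt, tilt]
  ring

lemma log_four_mul_neg {s : ℝ} (hs0 : 0 < s) (hs : s < 1 / 2) :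
    Real.log (4 * (s * (1 - s))) < 0 :=
  Real.log_neg (by nlinarith) (by nlinarith)

lemma log_four_mul_nonpos {s : ℝ} (hs0 : 0 < s) (hs : s ≤ 1 / 2) :
    Real.log (4 * (s * (1 - s))) ≤ 0 :=
  Real.log_nonpos (by nlinarith) (by nlinarith [sq_nonneg (1 - 2 * s)])

lemma g_zero (p : ℝ) : g p 0 = h p := by simp [g]

lemma g_self (p : ℝ) : g p p = 2 * p := by simp [g, h_zero]

/-- The tilt with the parameter optimal at `σ` is a supporting line: it touches `g p` at `σ`, lies
above it at `τ`, and has negative slope. No derivative is needed. -/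
lemma g_strictAntiOn {p : ℝ} (hp : p < 1 / 2) : StrictAntiOn (g p) (Set.Icc 0 p) := by
  intro σ hσ τ hτ hστ
  have hσ' : 0 < 1 - 2 * σ := by linarith [hσ.2]
  have hs0 : 0 < (p - σ) / (1 - 2 * σ) := div_pos (by linarith [hτ.2]) hσ'
  have hs1 : (p - σ) / (1 - 2 * σ) < 1 / 2 := by rw [div_lt_iff₀ hσ']; linarith
  have h1 := g_mul_log_two_le (s := (p - σ) / (1 - 2 * σ)) hτ.2 hp hs0 (by linarith)
  have h2 := g_mul_log_two p hσ'.ne'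
  have h3 := tilt_sub p hs0 (by linarith) σ τ
  have h4 := mul_neg_of_pos_of_neg (sub_pos.2 hστ) (log_four_mul_neg hs0 hs1)
  exact lt_of_mul_lt_mul_right (by linarith) log_two_pos.le

lemma continuousOn_g {p : ℝ} (hp : p < 1 / 2) : ContinuousOn (g p) (Set.Icc 0 p) := by
  have h1 : ContinuousOn (fun σ : ℝ => (p - σ) / (1 - 2 * σ)) (Set.Icc 0 p) :=
    ContinuousOn.div (by fun_prop) (by fun_prop) fun σ hσ => by linarith [hσ.2]
  unfold g
  exact ((continuousOn_const.sub (by fun_prop)).mul (continuous_h.comp_continuousOn h1)).add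
    (by fun_prop)

lemma bijOn_g {p : ℝ} (hp0 : 0 ≤ p) (hp : p < 1 / 2) :
    Set.BijOn (g p) (Set.Icc 0 p) (Set.Icc (2 * p) (h p)) := by
  refine ⟨fun σ hσ => ?_, (g_strictAntiOn hp).injOn, ?_⟩
  · have hanti := (g_strictAntiOn hp).antitoneOn
    rw [← g_self p, ← g_zero p]
    exact ⟨hanti hσ ⟨hp0, le_rfl⟩ hσ.2, hanti ⟨le_rfl, hp0⟩ hσ hσ.1⟩
  · have := intermediate_value_Icc' hp0 (continuousOn_g hp)
    rwa [g_self, g_zero] at this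

lemma gInv_mem {p y : ℝ} (hp0 : 0 ≤ p) (hp : p < 1 / 2) (h1 : 2 * p ≤ y) (h2 : y ≤ h p) :
    gInv p y ∈ Set.Icc 0 p :=
  (bijOn_g hp0 hp).surjOn.mapsTo_invFunOn ⟨h1, h2⟩

lemma g_gInv {p y : ℝ} (hp0 : 0 ≤ p) (hp : p < 1 / 2) (h1 : 2 * p ≤ y) (h2 : y ≤ h p) :
    g p (gInv p y) = y :=
  (bijOn_g hp0 hp).surjOn.rightInvOn_invFunOn ⟨h1, h2⟩

lemma gInv_h {p : ℝ} (hp0 : 0 ≤ p) (hp : p < 1 / 2) : gInv p (h p) = 0 := by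
  have h0 : (0 : ℝ) ∈ Set.Icc 0 p := ⟨le_rfl, hp0⟩
  have := (bijOn_g hp0 hp).injOn.leftInvOn_invFunOn h0
  rwa [g_zero] at this

lemma rate_self {p : ℝ} (hp0 : 0 ≤ p) (hp : p < 1 / 2) : rate p p p = h p := by
  simp [rate, gInv_h hp0 hp, h_zero]

/-! ### The binary symmetric channel -/

section BSC

variable {n : ℕ}

/-- The transition probabilities of the `n`-fold binary symmetric channel. -/
def bscW (s : ℝ) (x z : Word n) : ℝ := ∏ i, if x i = z i then 1 - s else s

lemma bsc_toReal (p : unitInterval) (x z : Word n) : (bsc n p x z).toReal = bscW p x z := by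
  rw [bsc, PMF.ofFintype_apply, ENNReal.toReal_prod, bscW]
  refine Finset.prod_congr rfl fun i _ => ENNReal.toReal_ofReal ?_
  split_ifs
  · linarith [p.2.2]
  · exact p.2.1

lemma bscW_nonneg {s : ℝ} (hs0 : 0 ≤ s) (hs1 : s ≤ 1) (x z : Word n) : 0 ≤ bscW s x z :=
  Finset.prod_nonneg fun i _ => by split_ifs <;> linarith

lemma bscW_le_one {s : ℝ} (hs0 : 0 ≤ s) (hs1 : s ≤ 1) (x z : Word n) : bscW s x z ≤ 1 :=
  Finset.prod_le_one (fun i _ => by split_ifs <;> linarith) fun i _ => by split_ifs <;> linarith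

lemma log_bscW {s : ℝ} (hs0 : 0 < s) (hs1 : s < 1) (x z : Word n) :
    Real.log (bscW s x z)
      = hammingDist x z * Real.log s + (n - hammingDist x z) * Real.log (1 - s) := by
  have h1 : ∀ i : Fin n, (if x i = z i then 1 - s else s) ≠ 0 := fun i => by
    split_ifs <;> linarith
  have h2 : ∀ i : Fin n, Real.log (if x i = z i then 1 - s else s)
      = (if x i ≠ z i then 1 else 0) * (Real.log s - Real.log (1 - s)) + Real.log (1 - s) := by
    intro i
    by_cases h : x i = z i <;> simp [h]
  rw [bscW, Real.log_prod fun i _ => h1 i, Finset.sum_congr rfl fun i _ => h2 i,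
    Finset.sum_add_distrib, ← Finset.sum_mul, Finset.sum_boole, Finset.sum_const,
    Finset.card_univ, Fintype.card_fin, nsmul_eq_mul, hammingDist]
  ring

lemma bscW_pos {s : ℝ} (hs0 : 0 < s) (hs1 : s < 1) (x z : Word n) : 0 < bscW s x z :=
  Finset.prod_pos fun i _ => by split_ifs <;> linarith

lemma sum_word_prod (f : Fin n → ZMod 2 → ℝ) :
    ∑ z : Word n, ∏ i, f i (z i) = ∏ i, ∑ b, f i b := by
  have h := Finset.prod_univ_sum (fun _ : Fin n => (Finset.univ : Finset (ZMod 2))) f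
  rw [Fintype.piFinset_univ] at h
  exact h.symm

lemma sum_zmod_two (f : ZMod 2 → ℝ) (a : ZMod 2) : ∑ b, f b = f a + f (a + 1) := by
  have h : ∑ b, f b = f 0 + f 1 := Fin.sum_univ_two f
  have ha : a = 0 ∨ a = 1 := by revert a; decide
  rw [h]
  rcases ha with rfl | rfl
  · rw [zero_add]
  · rw [show (1 : ZMod 2) + 1 = 0 by decide, add_comm]

lemma zmod_two_ne_add_one (a : ZMod 2) : a ≠ a + 1 := by revert a; decide

lemma zmod_two_add_one_of_ne {a b : ZMod 2} (h : a ≠ b) : a + 1 = b := by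
  revert a b; decide

lemma sum_bscW (s : ℝ) (x : Word n) : ∑ z, bscW s x z = 1 := by
  unfold bscW
  rw [sum_word_prod fun i b => if x i = b then 1 - s else s]
  refine Finset.prod_eq_one fun i _ => ?_
  rw [sum_zmod_two _ (x i), if_pos rfl, if_neg (zmod_two_ne_add_one _)]
  ring

/-- The Bhattacharyya coefficient of two output distributions. -/
lemma sum_sqrt_bscW_mul {s : ℝ} (hs0 : 0 ≤ s) (hs1 : s ≤ 1) (x y : Word n) :
    ∑ z, √(bscW s x z) * √(bscW s y z) = (2 * √(s * (1 - s))) ^ hammingDist x y := by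
  have h1 : ∀ z, √(bscW s x z) * √(bscW s y z)
      = ∏ i, √((if x i = z i then 1 - s else s) * (if y i = z i then 1 - s else s)) := by
    intro z
    rw [← Real.sqrt_mul (bscW_nonneg hs0 hs1 x z), bscW, bscW, ← Finset.prod_mul_distrib,
      Real.sqrt_prod]
    intro i _
    apply mul_nonneg <;> split_ifs <;> linarith
  rw [Finset.sum_congr rfl fun z _ => h1 z,
    sum_word_prod fun i b => √((if x i = b then 1 - s else s) * (if y i = b then 1 - s else s)),
    -- Coordinates where the inputs agree contribute a factor one; those where they differ
    -- contribute `2 √(s (1 - s))`.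
    hammingDist, ← Finset.prod_const, ← Finset.prod_filter_mul_prod_filter_not Finset.univ
      (fun i => x i ≠ y i)]
  rw [mul_comm, Finset.prod_eq_one, one_mul]
  · refine Finset.prod_congr rfl fun i hi => ?_
    have hne : x i ≠ y i := (Finset.mem_filter.1 hi).2
    rw [sum_zmod_two _ (x i), if_pos rfl, if_neg hne.symm, if_neg (zmod_two_ne_add_one _),
      if_pos (zmod_two_add_one_of_ne hne).symm, mul_comm (1 - s) s]
    ring
  · intro i hi
    have he : x i = y i := not_not.1 (Finset.mem_filter.1 hi).2
    rw [sum_zmod_two _ (x i), ← he, if_pos rfl, if_neg (zmod_two_ne_add_one _),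
      Real.sqrt_mul_self (by linarith), Real.sqrt_mul_self hs0]
    ring

/-- The number of words in the intersection of two Hamming balls of radius `r` whose centres
have distance at least `D`. -/
lemma card_inter_balls_le {s : ℝ} (hs0 : 0 < s) (hs : s ≤ 1 / 2) (x y : Word n) (r : ℝ) {D : ℝ}
    (hD : D ≤ hammingDist x y) :
    ((Finset.univ.filter fun z : Word n =>
        (hammingDist x z : ℝ) ≤ r ∧ (hammingDist y z : ℝ) ≤ r).card : ℝ)
      ≤ Real.exp (-r * Real.log s - (n - r) * Real.log (1 - s)
          + D / 2 * Real.log (4 * (s * (1 - s)))) := by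
  have hs1 : s < 1 := by linarith
  have hlog : Real.log s ≤ Real.log (1 - s) := Real.log_le_log hs0 (by linarith)
  -- `b` is the transition probability at distance exactly `r`. Since `s ≤ 1/2`, it is a lower bound
  -- at all smaller distances.
  set b : ℝ := Real.exp (r * Real.log s + (n - r) * Real.log (1 - s)) with hb
  have hpt : ∀ x z : Word n, (hammingDist x z : ℝ) ≤ r → b ≤ bscW s x z := by
    intro x z hxz
    rw [← Real.exp_log (bscW_pos hs0 hs1 x z), log_bscW hs0 hs1, hb, Real.exp_le_exp]
    nlinarith
  have hbs : √b * √b = b := Real.mul_self_sqrt (Real.exp_pos _).le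
  -- Each word of the intersection contributes at least `√b √b = b` to the Bhattacharyya sum.
  have hsum : ((Finset.univ.filter fun z : Word n =>
      (hammingDist x z : ℝ) ≤ r ∧ (hammingDist y z : ℝ) ≤ r).card : ℝ) * b
      ≤ (2 * √(s * (1 - s))) ^ hammingDist x y := by
    rw [← sum_sqrt_bscW_mul hs0.le hs1.le, ← nsmul_eq_mul, ← Finset.sum_const]
    refine (Finset.sum_le_sum fun z hz => ?_).trans
      (Finset.sum_le_sum_of_subset_of_nonneg (Finset.filter_subset _ _) fun z _ _ => by positivity)
    have hz := (Finset.mem_filter.1 hz).2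
    rw [← hbs]
    exact mul_le_mul (Real.sqrt_le_sqrt (hpt x z hz.1)) (Real.sqrt_le_sqrt (hpt y z hz.2))
      (Real.sqrt_nonneg _) (Real.sqrt_nonneg _)
  have hpos : 0 < s * (1 - s) := mul_pos hs0 (by linarith)
  have hpow : (2 * √(s * (1 - s))) ^ hammingDist x y
      ≤ Real.exp (D / 2 * Real.log (4 * (s * (1 - s)))) := by
    have h4 : 2 * √(s * (1 - s)) = √(4 * (s * (1 - s))) := by
      rw [show 4 * (s * (1 - s)) = 2 ^ 2 * (s * (1 - s)) by norm_num,
        Real.sqrt_mul (sq_nonneg 2), Real.sqrt_sq two_pos.le]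
    rw [h4, ← Real.exp_log (Real.sqrt_pos.2 (by positivity : 0 < 4 * (s * (1 - s)))),
      ← Real.exp_nat_mul, Real.exp_le_exp, Real.log_sqrt (by positivity)]
    have := log_four_mul_nonpos hs0 hs
    nlinarith
  have hbpos : 0 < b := Real.exp_pos _
  rw [← le_div_iff₀ hbpos] at hsum
  refine hsum.trans ((div_le_div_of_nonneg_right hpow hbpos.le).trans (le_of_eq ?_))
  rw [hb, ← Real.exp_sub]
  congr 1; ring

/-- The intersection bound with both centres equal, `D = 0` and the optimal parameter `s = τ`. -/
lemma card_ball_le {τ : ℝ} (hτ0 : 0 < τ) (hτ : τ ≤ 1 / 2) (x : Word n) :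
    ((Finset.univ.filter fun z : Word n => (hammingDist x z : ℝ) ≤ τ * n).card : ℝ)
      ≤ 2 ^ (n * h τ) := by
  have h1 := card_inter_balls_le hτ0 hτ x x (τ * n) (D := 0) (by simp)
  simp only [and_self] at h1
  refine h1.trans (le_of_eq ?_)
  rw [Real.rpow_def_of_pos two_pos, show Real.log 2 * (n * h τ) = n * (h τ * Real.log 2) by ring,
    h_mul_log_two, binEntropy_eq_neg]
  congr 1; ring

/-- The bound on the moment generating function of the number of errors. -/
lemma sum_bscW_mul_exp_le {p s : ℝ} (hp0 : 0 ≤ p) (hp1 : p ≤ 1) (hs : |s| ≤ 1) (x : Word n) :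
    ∑ z, bscW p x z * Real.exp (s * (hammingDist x z - n * p)) ≤ Real.exp (n * s ^ 2) := by
  have h1 : ∀ z : Word n, bscW p x z * Real.exp (s * (hammingDist x z - n * p))
      = ∏ i, (if x i = z i then (1 - p) * Real.exp (s * (0 - p))
          else p * Real.exp (s * (1 - p))) := by
    intro z
    have h2 : s * ((hammingDist x z : ℝ) - n * p)
        = ∑ i, s * ((if x i ≠ z i then 1 else 0) - p) := by
      rw [← Finset.mul_sum, Finset.sum_sub_distrib, Finset.sum_boole, hammingDist]
      simp
    rw [h2, Real.exp_sum, bscW, ← Finset.prod_mul_distrib]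
    refine Finset.prod_congr rfl fun i _ => ?_
    by_cases h : x i = z i <;> simp [h]
  rw [Finset.sum_congr rfl fun z _ => h1 z,
    sum_word_prod fun i b => if x i = b then (1 - p) * Real.exp (s * (0 - p))
          else p * Real.exp (s * (1 - p)), Real.exp_nat_mul]
  have hexp : ∀ u : ℝ, |u| ≤ 1 → Real.exp u ≤ 1 + u + u ^ 2 := fun u hu => by
    have := (abs_le.1 (Real.abs_exp_sub_one_sub_id_le hu)).2
    linarith
  have h0 : |s * (0 - p)| ≤ 1 := by
    rw [abs_mul]
    exact mul_le_one₀ hs (abs_nonneg _) (abs_le.2 ⟨by linarith, by linarith⟩)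
  have h1' : |s * (1 - p)| ≤ 1 := by
    rw [abs_mul]
    exact mul_le_one₀ hs (abs_nonneg _) (abs_le.2 ⟨by linarith, by linarith⟩)
  -- In `exp u ≤ 1 + u + u²` the linear terms cancel because the centred error has mean zero; its
  -- variance `p (1 - p)` is at most one.
  have hfac : (1 - p) * Real.exp (s * (0 - p)) + p * Real.exp (s * (1 - p))
      ≤ Real.exp (s ^ 2) := by
    have e0 := mul_le_mul_of_nonneg_left (hexp _ h0) (sub_nonneg.2 hp1)
    have e1 := mul_le_mul_of_nonneg_left (hexp _ h1') hp0
    have e2 := Real.add_one_le_exp (s ^ 2)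
    have e3 : p * (1 - p) * s ^ 2 ≤ 1 * s ^ 2 :=
      mul_le_mul_of_nonneg_right (by nlinarith) (sq_nonneg s)
    nlinarith
  calc _ = ∏ _i : Fin n, ((1 - p) * Real.exp (s * (0 - p)) + p * Real.exp (s * (1 - p))) := by
        refine Finset.prod_congr rfl fun i _ => ?_
        rw [sum_zmod_two _ (x i), if_pos rfl, if_neg (zmod_two_ne_add_one _)]
    _ = ((1 - p) * Real.exp (s * (0 - p)) + p * Real.exp (s * (1 - p))) ^ n := by simp
    _ ≤ _ := pow_le_pow_left₀ (by
        have := sub_nonneg.2 hp1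
        positivity) hfac n

/-- Markov's inequality for the exponential moment. Both signs of `s` are allowed because `log p -
log (1 - p)` takes both signs in the application to typical words. -/
lemma sum_bscW_tail_le {p s : ℝ} (hp0 : 0 ≤ p) (hp1 : p ≤ 1) (hs : |s| ≤ 1) (u : ℝ)
    (x : Word n) :
    ∑ z with u < s * (hammingDist x z - n * p), bscW p x z ≤ Real.exp (n * s ^ 2 - u) := by
  have h1 : ∑ z with u < s * (hammingDist x z - n * p), bscW p x z * Real.exp u
      ≤ Real.exp (n * s ^ 2) := by
    refine le_trans ?_ (sum_bscW_mul_exp_le hp0 hp1 hs x)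
    refine (Finset.sum_le_sum fun z hz => ?_).trans
      (Finset.sum_le_sum_of_subset_of_nonneg (Finset.filter_subset _ _) fun z _ _ =>
        mul_nonneg (bscW_nonneg hp0 hp1 x z) (Real.exp_pos _).le)
    exact mul_le_mul_of_nonneg_left (Real.exp_le_exp.2 (Finset.mem_filter.1 hz).2.le)
      (bscW_nonneg hp0 hp1 x z)
  rw [← Finset.sum_mul] at h1
  rwa [Real.exp_sub, le_div_iff₀ (Real.exp_pos _)]

lemma sum_bscW_errors_le {p δ : ℝ} (hp0 : 0 ≤ p) (hp1 : p ≤ 1) (hδ0 : 0 < δ) (hδ1 : δ ≤ 1)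
    (x : Word n) :
    ∑ z with (p + δ) * n < hammingDist x z, bscW p x z ≤ Real.exp (-(δ ^ 2 / 4 * n)) := by
  have h := sum_bscW_tail_le (s := δ / 2) hp0 hp1 (by rw [abs_of_pos] <;> linarith)
    (δ ^ 2 / 2 * n) x
  rw [show (n : ℝ) * (δ / 2) ^ 2 - δ ^ 2 / 2 * n = -(δ ^ 2 / 4 * n) by ring] at h
  refine le_trans (Finset.sum_le_sum_of_subset_of_nonneg ?_ fun z _ _ =>
    bscW_nonneg hp0 hp1 x z) h
  intro z hz
  simp only [Finset.mem_filter, Finset.mem_univ, true_and] at hz ⊢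
  nlinarith

/-- The log-likelihood plus `n` times the entropy equals `(log p - log (1 - p))` times the centred
number of errors, so atypicality is a tail event for that number. -/
lemma sum_bscW_atypical_le {p : ℝ} (hp0 : 0 < p) (hp1 : p < 1) {t u : ℝ} (ht0 : 0 < t)
    (ht : |(Real.log p - Real.log (1 - p)) * t| ≤ 1) (x : Word n) :
    ∑ z with Real.exp (u - n * Real.binEntropy p) < bscW p x z, bscW p x z
      ≤ Real.exp (n * ((Real.log p - Real.log (1 - p)) * t) ^ 2 - t * u) := by
  refine le_trans (Finset.sum_le_sum_of_subset_of_nonneg ?_ fun z _ _ =>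
    bscW_nonneg hp0.le hp1.le x z) (sum_bscW_tail_le hp0.le hp1.le ht (t * u) x)
  intro z hz
  simp only [Finset.mem_filter, Finset.mem_univ, true_and] at hz ⊢
  rw [← Real.lt_log_iff_exp_lt (bscW_pos hp0 hp1 x z), log_bscW hp0 hp1, binEntropy_eq_neg] at hz
  have := mul_lt_mul_of_pos_left hz ht0
  nlinarith

end BSC

/-! ### Colourings with well separated colour classes -/

/-- Greedy colouring. -/
lemma exists_coloring {α : Type} [Fintype α] [DecidableEq α] (adj : α → α → Prop)
    [DecidableRel adj] (hsymm : ∀ a b, adj a b → adj b a) (hirr : ∀ a, ¬ adj a a) {Q : ℕ}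
    (hQ : ∀ a, (Finset.univ.filter (adj a)).card < Q) :
    ∃ C : α → Fin Q, ∀ a b, adj a b → C a ≠ C b := by
  suffices H : ∀ s : Finset α, ∃ C : α → Fin Q, ∀ a ∈ s, ∀ b ∈ s, adj a b → C a ≠ C b by
    obtain ⟨C, hC⟩ := H Finset.univ
    exact ⟨C, fun a b => hC a (Finset.mem_univ _) b (Finset.mem_univ _)⟩
  intro s
  induction s using Finset.induction_on with
  | empty =>
    refine ⟨fun a => ⟨0, (Nat.zero_le _).trans_lt (hQ a)⟩, fun a ha => by simp at ha⟩
  | insert a s ha ih =>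
    obtain ⟨C, hC⟩ := ih
    obtain ⟨c, hc⟩ : ∃ c, c ∉ (Finset.univ.filter (adj a)).image C := by
      by_contra hcon
      push Not at hcon
      have h1 := Finset.card_le_card (fun c _ => hcon c : (Finset.univ : Finset (Fin Q)) ⊆ _)
      have h2 := Finset.card_image_le (s := Finset.univ.filter (adj a)) (f := C)
      have h3 := hQ a
      simp only [Finset.card_univ, Fintype.card_fin] at h1
      omega
    have hc' : ∀ b, adj a b → c ≠ C b := fun b hb hcb =>
      hc (Finset.mem_image.2 ⟨b, by simpa using hb, hcb.symm⟩)
    refine ⟨Function.update C a c, fun x hx y hy hxy => ?_⟩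
    rcases eq_or_ne x a with rfl | hxa <;> rcases eq_or_ne y x with rfl | hyx
    · exact absurd hxy (hirr _)
    · rw [Function.update_self, Function.update_of_ne hyx]
      exact hc' y hxy
    · exact absurd hxy (hirr _)
    · rw [Function.update_of_ne hxa]
      have hx' : x ∈ s := (Finset.mem_insert.1 hx).resolve_left hxa
      rcases eq_or_ne y a with rfl | hya
      · rw [Function.update_self]
        exact (hc' x (hsymm _ _ hxy)).symm
      · rw [Function.update_of_ne hya]
        exact hC x hx' y ((Finset.mem_insert.1 hy).resolve_left hya) hxy

/-- Words can be coloured so that distinct words of the same colour are far apart. -/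
lemma exists_separating_coloring (n : ℕ) {τ : ℝ} (hτ0 : 0 < τ) (hτ : τ ≤ 1 / 2) :
    ∃ (Q : ℕ) (C : Word n → Fin Q), (Q : ℝ) ≤ 2 ^ (n * h τ) ∧
      ∀ x y, C x = C y → x ≠ y → τ * n < hammingDist x y := by
  classical
  set B : Word n → Finset (Word n) := fun x =>
    Finset.univ.filter fun z : Word n => (hammingDist x z : ℝ) ≤ τ * n with hB
  have hmem : ∀ x, x ∈ B x := fun x => by
    simp only [hB, Finset.mem_filter, Finset.mem_univ, true_and, hammingDist_self]
    push_cast; positivity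
  -- Translation invariance: one number of colours serves all words.
  have hcard : ∀ x, (B x).card = (B 0).card := fun x => by
    refine Finset.card_bij (fun z _ => z - x) ?_ ?_ ?_
    · intro z hz
      simp only [hB, Finset.mem_filter, Finset.mem_univ, true_and] at hz ⊢
      rwa [hammingDist_zero_left, ← neg_add_eq_sub, ← hammingDist_eq_hammingNorm]
    · intro a _ b _ hab; exact sub_left_injective hab
    · intro z hz
      refine ⟨z + x, ?_, by simp⟩
      simp only [hB, Finset.mem_filter, Finset.mem_univ, true_and] at hz ⊢
      rw [hammingDist_zero_left] at hz
      rwa [hammingDist_eq_hammingNorm, neg_add_eq_sub, add_sub_cancel_right]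
  obtain ⟨C, hC⟩ := exists_coloring (Q := (B 0).card)
    (fun x y : Word n => x ≠ y ∧ (hammingDist x y : ℝ) ≤ τ * n)
    (fun x y hxy => ⟨hxy.1.symm, by rw [hammingDist_comm]; exact hxy.2⟩) (fun x hx => hx.1 rfl)
    -- The neighbours of `x` form its ball without the centre, so there are strictly fewer of them
    -- than colours.
    (fun x => by
      rw [← hcard x]
      refine Finset.card_lt_card ⟨fun z hz => ?_, fun hsub => ?_⟩
      · simp only [hB, Finset.mem_filter, Finset.mem_univ, true_and] at hz ⊢
        exact hz.2
      · simpa using hsub (hmem x))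
  refine ⟨(B 0).card, C, card_ball_le hτ0 hτ 0, fun x y hxy hne => ?_⟩
  by_contra hlt
  exact hC x y ⟨hne, not_lt.1 hlt⟩ hxy

/-! ### The trace norm of Hermitian matrices -/

section TraceNorm

variable {ι : Type} [Fintype ι]

lemma trace_re_nonneg {A : Matrix ι ι ℂ} (hA : A.PosSemidef) : 0 ≤ A.trace.re :=
  (Complex.nonneg_iff.1 hA.trace_nonneg).1

lemma trace_im_eq_zero {A : Matrix ι ι ℂ} (hA : A.PosSemidef) : A.trace.im = 0 :=
  (Complex.nonneg_iff.1 hA.trace_nonneg).2.symm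

variable [DecidableEq ι]

/-- As `Aᴴ * A = A²`, its eigenvalues are the squares of those of `A`. The two families may be
indexed differently, so they are compared as multisets of roots of the characteristic polynomial. -/
lemma traceNorm_eq_sum_abs {A : Matrix ι ι ℂ} (hA : A.IsHermitian) :
    traceNorm A = ∑ i, |hA.eigenvalues i| := by
  have hsq : Aᴴ * A = cfc (fun x : ℝ => x ^ 2) A := by
    rw [hA.eq, ← sq]
    exact (cfc_pow_id (R := ℝ) A 2 hA).symm
  have h1 := (Matrix.isHermitian_conjTranspose_mul_self A).roots_charpoly_eq_eigenvalues
  have h2 : (Aᴴ * A).charpoly.roots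
      = Multiset.map (fun i => ((hA.eigenvalues i ^ 2 : ℝ) : ℂ)) Finset.univ.val := by
    rw [hsq, hA.charpoly_cfc_eq, Polynomial.roots_prod _ _ (Finset.prod_ne_zero_iff.2 fun i _ =>
      Polynomial.X_sub_C_ne_zero _)]
    simp only [Polynomial.roots_X_sub_C, Multiset.bind_singleton]
    rfl
  rw [h2] at h1
  have h3 := congrArg (fun s => (Multiset.map (fun z : ℂ => √z.re) s).sum) h1
  simp only [Multiset.map_map, Function.comp_def] at h3
  have h4 : ∑ i, √(hA.eigenvalues i ^ 2)
      = ∑ i, √((Matrix.isHermitian_conjTranspose_mul_self A).eigenvalues i) := h3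
  rw [traceNorm, ← h4]
  exact Finset.sum_congr rfl fun i _ => Real.sqrt_sq_eq_abs _

lemma exists_diagonalization {A : Matrix ι ι ℂ} (hA : A.IsHermitian) :
    ∃ V : Matrix ι ι ℂ, Vᴴ * V = 1 ∧ V * Vᴴ = 1 ∧
      A = V * Matrix.diagonal (fun i => (hA.eigenvalues i : ℂ)) * Vᴴ := by
  refine ⟨hA.eigenvectorUnitary, ?_, ?_, ?_⟩
  · exact Unitary.coe_star_mul_self hA.eigenvectorUnitary
  · exact Unitary.coe_mul_star_self hA.eigenvectorUnitary
  · have h := hA.spectral_theorem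
    rw [Unitary.conjStarAlgAut_apply] at h
    exact h

/-- Duality and Jordan decomposition for the trace norm. -/
lemma exists_sign_and_jordan {A : Matrix ι ι ℂ} (hA : A.IsHermitian) :
    (∃ U : Matrix ι ι ℂ, U.IsHermitian ∧ U * U = 1 ∧ (U * A).trace.re = traceNorm A) ∧
    ∃ P N : Matrix ι ι ℂ, P.PosSemidef ∧ N.PosSemidef ∧ A = P - N ∧
      P.trace.re + N.trace.re = traceNorm A := by
  obtain ⟨V, hV1, hV2, hAV⟩ := exists_diagonalization hA
  set l := hA.eigenvalues
  have htr : ∀ D : Matrix ι ι ℂ, (V * D * Vᴴ).trace = D.trace := fun D => by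
    rw [Matrix.trace_mul_cycle, hV1, one_mul]
  have hmul : ∀ D E : Matrix ι ι ℂ, V * D * Vᴴ * (V * E * Vᴴ) = V * (D * E) * Vᴴ := fun D E => by
    calc _ = V * D * (Vᴴ * V) * E * Vᴴ := by simp only [mul_assoc]
      _ = _ := by rw [hV1]; simp only [mul_assoc, mul_one]
  have hpsd : ∀ f : ι → ℝ, (∀ i, 0 ≤ f i) →
      (V * Matrix.diagonal (fun i => (f i : ℂ)) * Vᴴ).PosSemidef := fun f hf =>
    (Matrix.PosSemidef.diagonal fun i => by
      simpa using hf i).mul_mul_conjTranspose_same V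
  have htr' : ∀ f : ι → ℝ, (V * Matrix.diagonal (fun i => (f i : ℂ)) * Vᴴ).trace.re
      = ∑ i, f i := fun f => by
    rw [htr, Matrix.trace_diagonal, ← Complex.ofReal_sum, Complex.ofReal_re]
  rw [traceNorm_eq_sum_abs hA]
  constructor
  -- The sign of `A`, with the value `1` on the kernel so that it squares to the identity.
  · refine ⟨V * Matrix.diagonal (fun i => ((if 0 ≤ l i then 1 else -1 : ℝ) : ℂ)) * Vᴴ, ?_, ?_, ?_⟩
    · have hD : (Matrix.diagonal (fun i => ((if 0 ≤ l i then 1 else -1 : ℝ) : ℂ)))ᴴ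
          = Matrix.diagonal (fun i => ((if 0 ≤ l i then 1 else -1 : ℝ) : ℂ)) := by
        rw [Matrix.diagonal_conjTranspose]
        congr 1
        funext i
        exact Complex.conj_ofReal _
      rw [Matrix.IsHermitian, Matrix.conjTranspose_mul, Matrix.conjTranspose_mul,
        Matrix.conjTranspose_conjTranspose, hD, mul_assoc]
    · rw [hmul, Matrix.diagonal_mul_diagonal]
      have : (fun i => ((if 0 ≤ l i then 1 else -1 : ℝ) : ℂ) * ((if 0 ≤ l i then 1 else -1 : ℝ) : ℂ))
          = fun _ => 1 := by
        funext i; split_ifs <;> simp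
      rw [this, Matrix.diagonal_one, mul_one, hV2]
    · conv_lhs => rw [hAV]
      rw [hmul, Matrix.diagonal_mul_diagonal]
      simp only [← Complex.ofReal_mul]
      rw [htr']
      refine Finset.sum_congr rfl fun i _ => ?_
      change (if 0 ≤ l i then 1 else -1) * l i = |l i|
      split_ifs with h
      · rw [one_mul, abs_of_nonneg h]
      · rw [abs_of_neg (not_le.1 h)]; ring
  · refine ⟨_, _, hpsd (fun i => max (l i) 0) fun i => le_max_right _ _,
      hpsd (fun i => max (-l i) 0) fun i => le_max_right _ _, ?_, ?_⟩
    · rw [← sub_mul, ← mul_sub, Matrix.diagonal_sub]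
      conv_lhs => rw [hAV]
      congr 3
      funext i
      rw [← Complex.ofReal_sub]
      congr 1
      rcases le_total 0 (l i) with h | h <;> simp [h, l]
    · rw [htr', htr', ← Finset.sum_add_distrib]
      refine Finset.sum_congr rfl fun i _ => ?_
      change max (l i) 0 + max (-l i) 0 = |l i|
      rcases le_total 0 (l i) with h | h
      · simp [h, abs_of_nonneg h]
      · simp [h, abs_of_nonpos h]

/-- Take the trace of the positive matrix `(1 - U) P (1 - U)`, using `(1 - U)² = 2 - 2 U`. -/
lemma trace_mul_re_le {U P : Matrix ι ι ℂ} (hU : U.IsHermitian) (hUU : U * U = 1)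
    (hP : P.PosSemidef) : (U * P).trace.re ≤ P.trace.re := by
  have h1 := trace_re_nonneg (hP.mul_mul_conjTranspose_same (1 - U))
  have h2 : ((1 - U) * P * (1 - U)ᴴ).trace = 2 * P.trace - 2 * (U * P).trace := by
    rw [Matrix.trace_mul_cycle, Matrix.conjTranspose_sub, hU.eq, Matrix.conjTranspose_one]
    have : (1 - U) * (1 - U) = 2 - 2 * U := by
      have : (1 - U) * (1 - U) = 1 - U - U + U * U := by noncomm_ring
      rw [this, hUU, two_mul, ← one_add_one_eq_two]; abel
    rw [this, sub_mul, Matrix.trace_sub, two_mul U, add_mul, Matrix.trace_add, two_mul P,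
      Matrix.trace_add]
    ring
  rw [h2] at h1
  simp only [Complex.sub_re, Complex.mul_re, Complex.re_ofNat, Complex.im_ofNat] at h1
  linarith

lemma traceNorm_sub_le {P N : Matrix ι ι ℂ} (hP : P.PosSemidef) (hN : N.PosSemidef) :
    traceNorm (P - N) ≤ P.trace.re + N.trace.re := by
  obtain ⟨⟨U, hU, hUU, hUA⟩, -⟩ := exists_sign_and_jordan (hP.1.sub hN.1)
  rw [← hUA, mul_sub, Matrix.trace_sub, Complex.sub_re]
  have h1 := trace_mul_re_le hU hUU hP
  have h2 := trace_mul_re_le hU.neg (by rw [neg_mul_neg, hUU]) hN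
  rw [neg_mul, Matrix.trace_neg, Complex.neg_re] at h2
  linarith

/-- Both the trace norm and the trace difference are at most `tr P + tr N`, and each enters with
weight one half. Later bounds on distances only have to exhibit such a decomposition. -/
lemma gtd_le_of_sub_eq {ρ σ P N : Matrix ι ι ℂ} (hP : P.PosSemidef) (hN : N.PosSemidef)
    (h : ρ - σ = P - N) : gtd ρ σ ≤ P.trace.re + N.trace.re := by
  have h1 := traceNorm_sub_le hP hN
  have h2 : ‖ρ.trace - σ.trace‖ ≤ P.trace.re + N.trace.re := by
    rw [← Matrix.trace_sub, h, Matrix.trace_sub]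
    refine (norm_sub_le _ _).trans (le_of_eq ?_)
    have : ∀ {B : Matrix ι ι ℂ}, B.PosSemidef → ‖B.trace‖ = B.trace.re := fun {B} hB => by
      rw [← abs_of_nonneg (trace_re_nonneg hB), Complex.abs_re_eq_norm.2 (trace_im_eq_zero hB)]
    rw [this hP, this hN]
  rw [gtd, h]
  linarith

/-- A weighted Hilbert-Schmidt bound on the trace norm. -/
lemma two_mul_traceNorm_le {A σ : Matrix ι ι ℂ} (hA : A.IsHermitian) (hσ : σ.PosDef) (t : ℝ) :
    2 * t * traceNorm A ≤ t ^ 2 * σ.trace.re + (A * σ⁻¹ * A).trace.re := by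
  obtain ⟨⟨U, hU, hUU, hUA⟩, -⟩ := exists_sign_and_jordan hA
  have hdet : IsUnit σ.det := (Matrix.isUnit_iff_isUnit_det _).1 hσ.isUnit
  -- Completing the square: the trace of `Xᴴ σ⁻¹ X` with `X = t σ U - A`, where `U` is the sign of
  -- `A`. This is Cauchy-Schwarz with a free parameter `t` and without a square root of `σ`.
  have h1 := trace_re_nonneg
    (hσ.inv.posSemidef.conjTranspose_mul_mul_same ((t : ℂ) • (σ * U) - A))
  have h2 : (((t : ℂ) • (σ * U) - A)ᴴ * σ⁻¹ * ((t : ℂ) • (σ * U) - A)).trace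
      = (t : ℂ) ^ 2 * σ.trace - 2 * t * (U * A).trace + (A * σ⁻¹ * A).trace := by
    have e1 : ((t : ℂ) • (σ * U) - A)ᴴ = (t : ℂ) • (U * σ) - A := by
      rw [Matrix.conjTranspose_sub, Matrix.conjTranspose_smul, Matrix.conjTranspose_mul, hU.eq,
        hσ.1.eq, hA.eq]
      congr 2
      exact Complex.conj_ofReal t
    have e2 : U * σ * σ⁻¹ = U := Matrix.mul_nonsing_inv_cancel_right _ _ hdet
    have e3 : A * σ⁻¹ * (σ * U) = A * U := by
      rw [mul_assoc, Matrix.nonsing_inv_mul_cancel_left _ _ hdet]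
    have e4 : (U * (σ * U)).trace = σ.trace := by
      rw [Matrix.trace_mul_comm, mul_assoc, hUU, mul_one]
    rw [e1, sub_mul, smul_mul_assoc, e2, mul_sub, sub_mul, sub_mul, mul_smul_comm, mul_smul_comm,
      smul_mul_assoc, smul_mul_assoc, e3]
    simp only [Matrix.trace_sub, Matrix.trace_smul, smul_eq_mul, e4]
    rw [Matrix.trace_mul_comm A U]
    ring
  rw [h2] at h1
  rw [← hUA]
  simp only [Complex.add_re, Complex.sub_re, ← Complex.ofReal_pow, Complex.re_ofReal_mul] at h1
  rw [show (2 : ℂ) * (t : ℂ) = ((2 * t : ℝ) : ℂ) by push_cast; ring, Complex.re_ofReal_mul] at h1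
  linarith

/-- If `ρ ≤ c σ` then `tr ρ σ⁻¹ ρ ≤ c tr ρ`. -/
lemma trace_mul_inv_mul_le {ρ σ : Matrix ι ι ℂ} (hρ : ρ.PosSemidef) (hσ : σ.PosDef) {c : ℝ}
    (hc : 0 < c) (h : ((c : ℂ) • σ - ρ).PosSemidef) :
    (ρ * σ⁻¹ * ρ).trace.re ≤ c * ρ.trace.re := by
  have hdet : IsUnit σ.det := (Matrix.isUnit_iff_isUnit_det _).1 hσ.isUnit
  set M := σ⁻¹ with hM
  have hMh : Mᴴ = M := hσ.inv.1.eq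
  have h1 := h.conjTranspose_mul_mul_same (M * ρ)
  -- In the sum of `h1` and `h2` the terms `ρ M ρ M ρ` cancel and `c² ρ - c ρ M ρ` remains, which
  -- has nonnegative trace.
  have h2 := hρ.conjTranspose_mul_mul_same ((c : ℂ) • (1 : Matrix ι ι ℂ) - M * ρ)
  have hstar : star (c : ℂ) = c := Complex.conj_ofReal c
  have e1 : (M * ρ)ᴴ * ((c : ℂ) • σ - ρ) * (M * ρ)
      = (c : ℂ) • (ρ * M * ρ) - ρ * M * ρ * M * ρ := by
    have e0 : ρ * M * σ = ρ := Matrix.nonsing_inv_mul_cancel_right _ _ hdet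
    rw [Matrix.conjTranspose_mul, hρ.1.eq, hMh, mul_sub, sub_mul, mul_smul_comm, smul_mul_assoc,
      e0]
    simp only [mul_assoc]
  have e2 : ((c : ℂ) • (1 : Matrix ι ι ℂ) - M * ρ)ᴴ * ρ * ((c : ℂ) • (1 : Matrix ι ι ℂ) - M * ρ)
      = (c : ℂ) • (c : ℂ) • ρ - (c : ℂ) • (ρ * M * ρ) - (c : ℂ) • (ρ * M * ρ)
        + ρ * M * ρ * M * ρ := by
    rw [Matrix.conjTranspose_sub, Matrix.conjTranspose_smul, Matrix.conjTranspose_mul, hρ.1.eq,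
      hMh, Matrix.conjTranspose_one, hstar]
    simp only [sub_mul, mul_sub, smul_mul_assoc, mul_smul_comm, one_mul, mul_one, mul_assoc,
      smul_sub]
    abel
  have h3 := trace_re_nonneg (h1.add h2)
  rw [e1, e2] at h3
  simp only [Matrix.trace_add, Matrix.trace_sub, Matrix.trace_smul, smul_eq_mul, Complex.add_re,
    Complex.sub_re, Complex.re_ofReal_mul] at h3
  have h4 : c * (ρ * M * ρ).trace.re ≤ c * (c * ρ.trace.re) := by linarith
  exact le_of_mul_le_mul_left h4 hc

end TraceNorm

/-! ### Leftover hashing against quantum side information -/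

/-- The quantum leftover hash lemma in terms of orthogonality relations of the coefficients. -/
lemma sum_traceNorm_le {β α J : Type} [Fintype β] [DecidableEq β] [Fintype α] [Fintype J]
    {σ : Matrix β β ℂ} (hσ : σ.PosDef) {b : ℝ} (hb : 0 < b) (ρ : α → Matrix β β ℂ)
    (hρ : ∀ x, (ρ x).PosSemidef) (hρσ : ∀ x, ((b : ℂ) • σ - ρ x).PosSemidef)
    (c : J → α → ℝ) {B : ℝ} (hdiag : ∀ x, ∑ j, c j x * c j x ≤ B)
    (horth : ∀ x y, x ≠ y → ∑ j, c j x * c j y = 0) (t : ℝ) :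
    2 * t * ∑ j, traceNorm (∑ x, (c j x : ℂ) • ρ x)
      ≤ t ^ 2 * Fintype.card J * σ.trace.re + B * (b * ∑ x, (ρ x).trace.re) := by
  classical
  have hherm : ∀ j, (∑ x, (c j x : ℂ) • ρ x).IsHermitian := fun j => by
    rw [Matrix.IsHermitian, Matrix.conjTranspose_sum]
    refine Finset.sum_congr rfl fun x _ => ?_
    rw [Matrix.conjTranspose_smul, (hρ x).1.eq]
    congr 1
    exact Complex.conj_ofReal _
  have h1 : ∀ j, 2 * t * traceNorm (∑ x, (c j x : ℂ) • ρ x) ≤ t ^ 2 * σ.trace.re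
      + ∑ x, ∑ y, (c j x * c j y) * (ρ x * σ⁻¹ * ρ y).trace.re := fun j => by
    refine (two_mul_traceNorm_le (hherm j) hσ t).trans (le_of_eq ?_)
    congr 1
    rw [Finset.sum_mul, Finset.sum_mul, Matrix.trace_sum, Complex.re_sum]
    refine Finset.sum_congr rfl fun x _ => ?_
    rw [Finset.mul_sum, Matrix.trace_sum, Complex.re_sum]
    refine Finset.sum_congr rfl fun y _ => ?_
    rw [smul_mul_assoc, smul_mul_assoc, mul_smul_comm, Matrix.trace_smul, Matrix.trace_smul,
      smul_eq_mul, smul_eq_mul, Complex.re_ofReal_mul, Complex.re_ofReal_mul]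
    ring
  rw [Finset.mul_sum]
  refine (Finset.sum_le_sum fun j _ => h1 j).trans ?_
  rw [Finset.sum_add_distrib, Finset.sum_const, Finset.card_univ, nsmul_eq_mul]
  refine add_le_add (le_of_eq (by ring)) ?_
  -- Summing over `j` first kills the cross terms `x ≠ y`; only the collision terms `ρ x σ⁻¹ ρ x`
  -- survive.
  rw [Finset.sum_comm, Finset.mul_sum, Finset.mul_sum]
  refine Finset.sum_le_sum fun x _ => ?_
  rw [Finset.sum_comm, Finset.sum_eq_single x]
  · rw [← Finset.sum_mul]
    have h2 := trace_mul_inv_mul_le (hρ x) hσ hb (hρσ x)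
    have h3 : 0 ≤ (ρ x * σ⁻¹ * ρ x).trace.re := by
      have := hσ.inv.posSemidef.conjTranspose_mul_mul_same (ρ x)
      rw [(hρ x).1.eq] at this
      exact trace_re_nonneg this
    have h4 : 0 ≤ ∑ j, c j x * c j x := Finset.sum_nonneg fun j _ => mul_self_nonneg _
    exact mul_le_mul (hdiag x) h2 h3 (h4.trans (hdiag x))
  · intro y _ hyx
    rw [← Finset.sum_mul, horth x y hyx.symm, zero_mul]
  · simp

/-! ### The commitment protocol -/

/-- The symbols of the commitment protocol. -/
abbrev Symbol (n Q K : ℕ) : Type := (Fin Q × (Word n → Fin K) × Fin K) ⊕ Word n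

instance (n Q K : ℕ) : DecidableEq (Symbol n Q K) := Classical.decEq _

/-- The commit phase: Alice sends a random word `x` over the noisy channel and then publishes
its colour `C x`, a random function `F`, and the message masked by `F x`. In the reveal phase she
sends `x`; Bob checks the colour and that `x` is within distance `r` of his word. -/
def hashProtocol (n Q K : ℕ) [NeZero K] (C : Word n → Fin Q) (r : ℝ) : Protocol n (Fin K) where
  T := Symbol n Q K
  pre := 0
  post := 1
  reveal := 1
  RA := Word n × (Word n → Fin K)
  distA := PMF.uniformOfFintype _
  RB := Unit
  distB := PMF.pure ()
  RV := Unit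
  distV := PMF.pure ()
  aliceCommit rA m _ := Sum.inl (C rA.1, rA.2, rA.2 rA.1 + m)
  aliceInput rA _ _ := rA.1
  aliceReveal rA _ _ _ := Sum.inr rA.1
  bobPre _ _ := Sum.inr 0
  bobPost _ _ _ := Sum.inr 0
  bobReveal _ _ _ _ _ := Sum.inr 0
  output _ _ z as rs :=
    match as, rs with
    | Sum.inl (y, F, c) :: _, Sum.inr x :: _ =>
      open Classical in
      if C x = y ∧ (hammingDist x z : ℝ) ≤ r then (c - F x, true) else (0, false)
    | _, _ => (0, false)

section Protocol

variable {n Q K : ℕ} [NeZero K] {C : Word n → Fin Q} {r : ℝ}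

lemma honestRun_hashProtocol (W : Word n → PMF (Word n)) (m : Fin K) :
    (hashProtocol n Q K C r).honestRun W m
      = (PMF.uniformOfFintype (Word n × (Word n → Fin K))).bind fun rA =>
        (W rA.1).map fun z =>
          open Classical in if (hammingDist rA.1 z : ℝ) ≤ r then (m, true) else (0, false) := by
  classical
  simp only [Protocol.honestRun, Protocol.commitRun, hashProtocol, PMF.pure_bind, PMF.pure_map,
    PMF.bind_map]
  refine congrArg _ (funext fun rA => congrArg (PMF.bind _) (funext fun z => congrArg PMF.pure ?_))
  simp only [Protocol.revealRun, rounds, aliceHist, true_and,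
    add_sub_cancel_left]

lemma sum_filter_bsc_eq (p : unitInterval) (x : Word n) (s : Finset (Word n)) :
    ∑ z ∈ s, bsc n p x z = ENNReal.ofReal (∑ z ∈ s, bscW p x z) := by
  rw [ENNReal.ofReal_sum_of_nonneg fun z _ => bscW_nonneg p.2.1 p.2.2 x z]
  refine Finset.sum_congr rfl fun z _ => ?_
  rw [← bsc_toReal, ENNReal.ofReal_toReal ((bsc n p x).apply_ne_top z)]

lemma deltaC_hashProtocol_le {mod : Model n} {p : unitInterval} (hmod : mod.honest = bsc n p)
    {ε : ℝ} (hε : ∀ x : Word n, ∑ z with r < hammingDist x z, bscW p x z ≤ ε) :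
    (hashProtocol n Q K C r).deltaC mod ≤ ENNReal.ofReal ε := by
  classical
  refine iSup_le fun m => ?_
  rw [tsub_le_iff_right, honestRun_hashProtocol, hmod, PMF.bind_apply]
  have h1 : ∀ rA : Word n × (Word n → Fin K), 1 ≤ ENNReal.ofReal ε + ((bsc n p rA.1).map fun z =>
      if (hammingDist rA.1 z : ℝ) ≤ r then (m, true) else ((0 : Fin K), false)) (m, true) := by
    intro rA
    have h2 : ∑ z : Word n, bsc n p rA.1 z = 1 := by
      rw [← tsum_fintype (L := SummationFilter.unconditional _)]; exact (bsc n p rA.1).tsum_coe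
    rw [← h2, PMF.map_apply, tsum_fintype,
      ← Finset.sum_filter_add_sum_filter_not Finset.univ (fun z => r < (hammingDist rA.1 z : ℝ))]
    refine add_le_add ?_ ?_
    · rw [sum_filter_bsc_eq]
      exact ENNReal.ofReal_le_ofReal (hε rA.1)
    · rw [Finset.sum_filter]
      refine Finset.sum_le_sum fun z _ => ?_
      by_cases h : r < (hammingDist rA.1 z : ℝ)
      · simp [h]
      · simp [h, not_lt.1 h]
  have h3 : ∑' rA, PMF.uniformOfFintype (Word n × (Word n → Fin K)) rA = 1 := PMF.tsum_coe _
  calc (1 : ℝ≥0∞) = ∑' rA, PMF.uniformOfFintype (Word n × (Word n → Fin K)) rA * 1 := by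
        simp only [mul_one, h3]
    _ ≤ ∑' rA, PMF.uniformOfFintype (Word n × (Word n → Fin K)) rA *
          (ENNReal.ofReal ε + ((bsc n p rA.1).map fun z =>
      if (hammingDist rA.1 z : ℝ) ≤ r then (m, true) else ((0 : Fin K), false)) (m, true)) :=
        ENNReal.tsum_le_tsum fun rA => mul_le_mul_right (h1 rA) _
    _ = _ := by
        simp only [mul_add]
        rw [ENNReal.tsum_add, ENNReal.tsum_mul_right, h3, one_mul, add_comm]

lemma toOuterMeasure_bind_le {α β : Type} (p : PMF α) (f : α → PMF β) (s : Set β) {b : ℝ≥0∞}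
    (h : ∀ a, (f a).toOuterMeasure s ≤ b) : (p.bind f).toOuterMeasure s ≤ b := by
  rw [PMF.toOuterMeasure_bind_apply]
  calc ∑' a, p a * (f a).toOuterMeasure s ≤ ∑' a, p a * b :=
        ENNReal.tsum_le_tsum fun a => mul_le_mul_right (h a) _
    _ = b := by rw [ENNReal.tsum_mul_right, p.tsum_coe, one_mul]

/-- Bob's replies are constant, so Alice learns nothing about `z`: both revealed symbols are
functions of her randomness alone. -/
lemma bindingRun_hashProtocol {c : AliceChannel n} (A : (hashProtocol n Q K C r).AliceStrategy c) :
    (hashProtocol n Q K C r).bindingRun A = A.dist.bind fun s => (c.W (A.input s [])).map fun z =>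
      ((hashProtocol n Q K C r).output () () z [A.commit s []] [A.reveal 0 s [Sum.inr 0] []],
        (hashProtocol n Q K C r).output () () z [A.commit s []] [A.reveal 1 s [Sum.inr 0] []]) := by
  simp only [Protocol.bindingRun, Protocol.commitRun, hashProtocol, PMF.pure_bind, PMF.pure_map,
    PMF.bind_map]
  rfl

lemma output_hashProtocol_eq_true {z : Word n} {t a : (hashProtocol n Q K C r).T}
    (h : ((hashProtocol n Q K C r).output () () z [t] [a]).2 = true) :
    ∃ y F c x, t = Sum.inl (y, F, c) ∧ a = Sum.inr x ∧ C x = y ∧ (hammingDist x z : ℝ) ≤ r ∧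
      ((hashProtocol n Q K C r).output () () z [t] [a]).1 = c - F x := by
  classical
  rcases t with ⟨y, F, c⟩ | t
  · rcases a with a | x
    · simp [hashProtocol] at h
    · by_cases hx : C x = y ∧ (hammingDist x z : ℝ) ≤ r
      · refine ⟨y, F, c, x, rfl, rfl, hx.1, hx.2, ?_⟩
        simp [hashProtocol, hx]
      · simp [hashProtocol, hx] at h
  · simp [hashProtocol] at h

/-- For fixed randomness the two revealed words are fixed. If both are accepted they share the
published colour, and if the messages `c - F x` differ then so do the words; `z` must then lie in
both balls. -/
lemma deltaB_hashProtocol_le {mod : Model n} {ε : ℝ≥0∞}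
    (hε : ∀ c ∈ mod.alice, ∀ i, ∀ x₀ x₁ : Word n, C x₀ = C x₁ → x₀ ≠ x₁ →
      (c.W i).toOuterMeasure {z | (hammingDist x₀ z : ℝ) ≤ r ∧ (hammingDist x₁ z : ℝ) ≤ r} ≤ ε) :
    (hashProtocol n Q K C r).deltaB mod ≤ ε := by
  refine iSup₂_le fun c hc => iSup_le fun A => ?_
  rw [bindingRun_hashProtocol]
  refine toOuterMeasure_bind_le _ _ _ fun s => ?_
  rw [PMF.toOuterMeasure_map_apply]
  by_cases hacc : ∃ x₀ x₁ : Word n, A.reveal 0 s [Sum.inr 0] [] = Sum.inr x₀ ∧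
      A.reveal 1 s [Sum.inr 0] [] = Sum.inr x₁ ∧ C x₀ = C x₁ ∧ x₀ ≠ x₁
  · obtain ⟨x₀, x₁, h0, h1, hC, hne⟩ := hacc
    refine le_trans (MeasureTheory.measure_mono ?_) (hε c hc (A.input s []) x₀ x₁ hC hne)
    rintro z ⟨hz0, hz1, -⟩
    obtain ⟨y, F, c, x, -, hx, -, hd, -⟩ := output_hashProtocol_eq_true hz0
    obtain ⟨y', F', c', x', -, hx', -, hd', -⟩ := output_hashProtocol_eq_true hz1
    rw [h0] at hx
    rw [h1] at hx'
    cases hx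
    cases hx'
    exact ⟨hd, hd'⟩
  · refine le_trans (le_of_eq ?_) (zero_le)
    convert MeasureTheory.measure_empty (μ := (c.W (A.input s [])).toOuterMeasure)
    refine Set.eq_empty_iff_forall_notMem.2 ?_
    rintro z ⟨hz0, hz1, hz⟩
    obtain ⟨y, F, c, x, ht, hx, hC, hd, he⟩ := output_hashProtocol_eq_true hz0
    obtain ⟨y', F', c', x', ht', hx', hC', hd', he'⟩ := output_hashProtocol_eq_true hz1
    rw [ht] at ht'
    cases ht'
    refine hacc ⟨x, x', hx, hx', hC.trans hC'.symm, ?_⟩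
    rintro rfl
    exact hz (he.trans he'.symm)

end Protocol

/-- A distribution with large smooth min-entropy gives small probability to small sets. -/
lemma sum_le_of_le_smoothMinEntropy {α : Type} [Fintype α] {P : α → ℝ} {ε l : ℝ}
    (h : (l : EReal) ≤ smoothMinEntropy ε P) (s : Finset α) :
    ∑ x ∈ s, P x ≤ s.card * 2 ^ (1 - l) + 2 * ε := by
  -- Giving up one bit produces an actual smoothing distribution without proving that the supremum
  -- is attained; hence the exponent `1 - l`.
  have h1 : ((l - 1 : ℝ) : EReal) < smoothMinEntropy ε P :=
    lt_of_lt_of_le (EReal.coe_lt_coe_iff.2 (by linarith)) h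
  simp only [smoothMinEntropy, lt_iSup_iff] at h1
  obtain ⟨R, ⟨-, -, hgtd⟩, hR⟩ := h1
  rw [minEntropy, EReal.lt_neg_comm] at hR
  simp only [iInf_lt_iff] at hR
  obtain ⟨l', hl', hlt⟩ := hR
  rw [← EReal.coe_neg, EReal.coe_lt_coe_iff] at hlt
  have h2 : ∑ x ∈ s, |R x - P x| ≤ 2 * ε := by
    have h3 : ∑ x ∈ s, |R x - P x| ≤ ∑ x, |R x - P x| :=
      Finset.sum_le_sum_of_subset_of_nonneg (Finset.subset_univ _) fun _ _ _ => abs_nonneg _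
    have h4 := abs_nonneg (∑ x, (R x - P x))
    rw [gtdClassical] at hgtd
    linarith
  have h5 : ∀ x, R x ≤ 2 ^ (1 - l) := fun x =>
    (hl' x).trans (Real.rpow_le_rpow_of_exponent_le one_le_two (by linarith))
  calc ∑ x ∈ s, P x ≤ ∑ x ∈ s, ((2 : ℝ) ^ (1 - l) + |R x - P x|) :=
        Finset.sum_le_sum fun x _ => by
          have := neg_abs_le (R x - P x)
          linarith [h5 x]
    _ ≤ _ := by
        rw [Finset.sum_add_distrib, Finset.sum_const, nsmul_eq_mul]
        linarith

lemma toOuterMeasure_finset_eq {α : Type} (P : PMF α) (s : Finset α) :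
    P.toOuterMeasure s = ENNReal.ofReal (∑ x ∈ s, (P x).toReal) := by
  rw [PMF.toOuterMeasure_apply_finset, ENNReal.ofReal_sum_of_nonneg fun _ _ => ENNReal.toReal_nonneg]
  exact Finset.sum_congr rfl fun x _ => (ENNReal.ofReal_toReal (P.apply_ne_top x)).symm

/-! ### Hiding -/

section Instrument

variable {ι O : Type} [Fintype ι] [DecidableEq ι] [Fintype O] (I : Instrument ι O)

/-- The map of an instrument for a fixed outcome, as a linear map. -/
def Instrument.applyLin (o : O) : Matrix ι ι ℂ →ₗ[ℂ] Matrix ι ι ℂ where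
  toFun := I.apply o
  map_add' ρ σ := by
    simp only [Instrument.apply, mul_add, add_mul, Finset.sum_add_distrib]
  map_smul' a ρ := by
    simp only [Instrument.apply, mul_smul_comm, smul_mul_assoc, Finset.smul_sum, RingHom.id_apply]

lemma Instrument.posSemidef_apply (o : O) {ρ : Matrix ι ι ℂ} (hρ : ρ.PosSemidef) :
    (I.apply o ρ).PosSemidef :=
  Matrix.posSemidef_sum _ fun k _ => hρ.mul_mul_conjTranspose_same (I.K o k)

lemma Instrument.sum_trace_apply (ρ : Matrix ι ι ℂ) : ∑ o, (I.apply o ρ).trace = ρ.trace := by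
  simp only [Instrument.apply, Matrix.trace_sum]
  have h : ∀ o k, (I.K o k * ρ * (I.K o k)ᴴ).trace = ((I.K o k)ᴴ * I.K o k * ρ).trace :=
    fun o k => Matrix.trace_mul_cycle _ _ _
  simp only [h, ← Matrix.trace_sum, ← Finset.sum_mul, I.complete, one_mul]

end Instrument

lemma posSemidef_blockDiagonal {ι κ : Type} [Fintype ι] [Fintype κ] [DecidableEq κ]
    {A : κ → Matrix ι ι ℂ} (hA : ∀ k, (A k).PosSemidef) :
    (Matrix.blockDiagonal A).PosSemidef := by
  refine Matrix.PosSemidef.of_dotProduct_mulVec_nonneg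
    (Matrix.isHermitian_blockDiagonal_iff.2 fun k => (hA k).1) fun v => ?_
  have h : star v ⬝ᵥ (Matrix.blockDiagonal A *ᵥ v)
      = ∑ k, star (fun i => v (i, k)) ⬝ᵥ (A k *ᵥ fun i => v (i, k)) := by
    simp only [dotProduct, Matrix.mulVec, Fintype.sum_prod_type, Matrix.blockDiagonal_apply,
      Pi.star_apply, ite_mul, zero_mul]
    rw [Finset.sum_comm]
    refine Finset.sum_congr rfl fun k _ => Finset.sum_congr rfl fun i _ => ?_
    congr 1
    refine Finset.sum_congr rfl fun j _ => ?_
    simp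
  rw [h]
  exact Finset.sum_nonneg fun k _ => (hA k).dotProduct_mulVec_nonneg _

/-- Vectors of length one. -/
def vectorOneEquiv (T : Type) : T ≃ List.Vector T 1 where
  toFun a := ⟨[a], rfl⟩
  invFun v := v.head
  left_inv _ := rfl
  right_inv v := by
    obtain ⟨l, hl⟩ := v
    obtain ⟨a, rfl⟩ := List.length_eq_one_iff.1 hl
    rfl

/-- The index type is that of Bob's view when `pre = 0` and `post = 1`; only Alice's symbol and one
reply are left to sum over. -/
lemma sum_commit_transcripts {T : Type} [Fintype T] (f : List T → List T → List T → ℝ) :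
    ∑ t : List.Vector T (0 + 1) × List.Vector T 0 × List.Vector T 1,
      f t.1.toList t.2.1.toList t.2.2.toList = ∑ a, ∑ b, f [a] [] [b] := by
  simp only [Fintype.sum_prod_type]
  rw [← (vectorOneEquiv T).sum_comp]
  refine Finset.sum_congr rfl fun a _ => ?_
  rw [Fintype.sum_eq_single (List.Vector.nil : List.Vector T 0) fun v hv =>
    absurd (List.Vector.eq_nil v) hv, ← (vectorOneEquiv T).sum_comp]
  rfl

section Protocol

variable {n Q K : ℕ} [NeZero K] {C : Word n → Fin Q} {r : ℝ}

/-- The probability, over the choice of the function, that the honest Alice who holds the word `x`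
and commits to `m` sends the symbol `a`. -/
def symbolProb (C : Word n → Fin Q) (m : Fin K) : Symbol n Q K → Word n → ℝ
  | Sum.inl (y, F, c), x =>
    if C x = y ∧ F x + m = c then (Fintype.card (Word n → Fin K) : ℝ)⁻¹ else 0
  | Sum.inr _, _ => 0

lemma symbolProb_nonneg (m : Fin K) (a : Symbol n Q K) (x : Word n) : 0 ≤ symbolProb C m a x := by
  rcases a with ⟨y, F, c⟩ | a
  · simp only [symbolProb]
    split_ifs <;> positivity
  · exact le_rfl

lemma sum_symbolProb (m : Fin K) (x : Word n) : ∑ a, symbolProb C m a x = 1 := by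
  rw [Fintype.sum_sum_type]
  simp only [symbolProb, Finset.sum_const_zero, add_zero, Fintype.sum_prod_type, ite_and]
  simp

/-- The sum over Alice's randomness in the view of Bob. -/
lemma sum_randomness_eq {V : Type} [AddCommGroup V] [Module ℂ V] (m : Fin K) (a : Symbol n Q K)
    (f : Word n → V) :
    ∑ rA : Word n × (Word n → Fin K),
      (if (Sum.inl (C rA.1, rA.2, rA.2 rA.1 + m) : Symbol n Q K) = a then
        ((PMF.uniformOfFintype (Word n × (Word n → Fin K)) rA).toReal : ℂ) • f rA.1 else 0)
      = ∑ x, ((symbolProb C m a x * (Fintype.card (Word n) : ℝ)⁻¹ : ℝ) : ℂ) • f x := by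
  classical
  rw [Fintype.sum_prod_type]
  refine Finset.sum_congr rfl fun x _ => ?_
  rcases a with ⟨y, F, c⟩ | a
  · simp only [Sum.inl.injEq, Prod.mk.injEq, PMF.uniformOfFintype_apply, Fintype.card_prod,
      symbolProb]
    rw [Fintype.sum_eq_single F]
    · by_cases h : C x = y ∧ F x + m = c
      · rw [if_pos ⟨h.1, rfl, h.2⟩, if_pos h]
        simp only [ENNReal.toReal_inv, ENNReal.toReal_natCast]
        congr 2
        push_cast
        rw [mul_inv, mul_comm]
      · rw [if_neg fun h' => h ⟨h'.1, h'.2.2⟩, if_neg h]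
        simp
    · intro F' hF'
      exact if_neg fun h => hF' h.2.1
  · simp [symbolProb]

/-- The unnormalized state of Bob's registers at the end of the commit phase on the branch with
symbols `as` and replies `bs`, when the state of the channel output is `R a` for Alice's
symbol `a`. -/
def branchState {c : BobChannel n} (S : (hashProtocol n Q K C r).BobStrategy c)
    (R : Symbol n Q K → Matrix c.B c.B ℂ) (as bs : List (Symbol n Q K)) :
    Matrix (S.E × c.B) (S.E × c.B) ℂ :=
  -- The default `Sum.inr 0` never matters in a transcript, where both lists have length one.
  (S.post as []).apply (bs.headD (Sum.inr 0) : Symbol n Q K)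
    (Matrix.kronecker S.init (R (as.headD (Sum.inr 0))))

/-- `branchState` as a linear map of the channel output. -/
def branchLin {c : BobChannel n} (S : (hashProtocol n Q K C r).BobStrategy c)
    (as bs : List (Symbol n Q K)) :
    Matrix c.B c.B ℂ →ₗ[ℂ] Matrix (S.E × c.B) (S.E × c.B) ℂ :=
  (S.post as []).applyLin (bs.headD (Sum.inr 0) : Symbol n Q K) ∘ₗ
    Matrix.kroneckerBilinear (R := ℂ) (n := c.B) (p := c.B) S.init

lemma branchState_eq {c : BobChannel n} (S : (hashProtocol n Q K C r).BobStrategy c)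
    (R : Symbol n Q K → Matrix c.B c.B ℂ) (as bs : List (Symbol n Q K)) :
    branchState S R as bs = branchLin S as bs (R (as.headD (Sum.inr 0))) := rfl

lemma branchState_sub_eq {c : BobChannel n} (S : (hashProtocol n Q K C r).BobStrategy c)
    {R R' P N : Symbol n Q K → Matrix c.B c.B ℂ} (h : ∀ a, R a - R' a = P a - N a)
    (as bs : List (Symbol n Q K)) :
    branchState S R as bs - branchState S R' as bs
      = branchState S P as bs - branchState S N as bs := by
  simp only [branchState_eq]
  rw [← map_sub, ← map_sub, h]

/-- The state of the channel output, weighted with the probability of Alice's symbol. -/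
def symbolState (C : Word n → Fin Q) (c : BobChannel n) (m : Fin K) (a : Symbol n Q K) :
    Matrix c.B c.B ℂ :=
  ∑ x, ((symbolProb C m a x * (Fintype.card (Word n) : ℝ)⁻¹ : ℝ) : ℂ) • c.W x

lemma branchState_symbolState {c : BobChannel n} (S : (hashProtocol n Q K C r).BobStrategy c)
    (m : Fin K) (a b : (hashProtocol n Q K C r).T) :
    (∑ rA : (hashProtocol n Q K C r).RA,
      if aliceHist ((hashProtocol n Q K C r).aliceCommit rA m) ([b] ++ []) = [a] then
        (((hashProtocol n Q K C r).distA rA).toReal : ℂ) •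
          S.postState ((hashProtocol n Q K C r).aliceCommit rA m)
            ((hashProtocol n Q K C r).aliceInput rA m []) [] [b]
      else 0) = branchState S (symbolState C c m) [a] [b] := by
  rw [branchState_eq, symbolState, map_sum]
  simp only [map_smul]
  refine Eq.trans ?_ (sum_randomness_eq m a fun x => branchLin S [a] [b] (c.W x))
  refine Finset.sum_congr rfl fun rA _ => ?_
  by_cases h : (Sum.inl (C rA.1, rA.2, rA.2 rA.1 + m) : Symbol n Q K) = a
  · rw [if_pos h]
    subst h
    exact if_pos rfl
  · rw [if_neg h]
    exact if_neg fun h' => h (List.cons.inj h').1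

lemma view_hashProtocol {c : BobChannel n} (S : (hashProtocol n Q K C r).BobStrategy c)
    (m : Fin K) :
    S.view m = Matrix.blockDiagonal fun t =>
      branchState S (symbolState C c m) t.1.toList t.2.2.toList := by
  rw [Protocol.BobStrategy.view]
  congr 1
  funext t
  obtain ⟨⟨as, has⟩, ⟨bs₀, hbs₀⟩, ⟨bs, hbs⟩⟩ := t
  obtain ⟨a, rfl⟩ := List.length_eq_one_iff.1 has
  obtain rfl := List.length_eq_zero_iff.1 hbs₀
  obtain ⟨b, rfl⟩ := List.length_eq_one_iff.1 hbs
  exact branchState_symbolState S m a b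

lemma posSemidef_branchState {c : BobChannel n} (S : (hashProtocol n Q K C r).BobStrategy c)
    {R : Symbol n Q K → Matrix c.B c.B ℂ} (hR : ∀ a, (R a).PosSemidef)
    (as bs : List (Symbol n Q K)) : (branchState S R as bs).PosSemidef :=
  (S.post as []).posSemidef_apply _ (S.init_isState.1.kronecker (hR _))

/-- Summed over his replies, Bob's instrument preserves the trace, and his initial state has trace
one. -/
lemma trace_blockDiagonal_branchState {c : BobChannel n}
    (S : (hashProtocol n Q K C r).BobStrategy c) (R : Symbol n Q K → Matrix c.B c.B ℂ) :
    (Matrix.blockDiagonal fun t : List.Vector (Symbol n Q K) (0 + 1) ×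
      List.Vector (Symbol n Q K) 0 × List.Vector (Symbol n Q K) 1 =>
        branchState S R t.1.toList t.2.2.toList).trace.re = ∑ a, (R a).trace.re := by
  rw [Matrix.trace_blockDiagonal, Complex.re_sum]
  refine (sum_commit_transcripts fun as _ bs => (branchState S R as bs).trace.re).trans ?_
  refine Finset.sum_congr rfl fun a _ => ?_
  have h1 := (S.post [a] []).sum_trace_apply (Matrix.kronecker S.init (R a))
  have h2 : (Matrix.kronecker S.init (R a)).trace = (R a).trace := by
    refine (Matrix.trace_kronecker _ _).trans ?_
    rw [S.init_isState.2, one_mul]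
  rw [← h2, ← h1, Complex.re_sum]
  rfl

/-- Data processing: Bob's operations are linear, positive and in total trace preserving, so a
decomposition into positive parts at the channel output carries over to his view at no cost. From
here on his strategy plays no role. -/
lemma gtd_view_le {c : BobChannel n} (S : (hashProtocol n Q K C r).BobStrategy c) (m m' : Fin K)
    {P N : Symbol n Q K → Matrix c.B c.B ℂ} (hP : ∀ a, (P a).PosSemidef)
    (hN : ∀ a, (N a).PosSemidef)
    (h : ∀ a, symbolState C c m a - symbolState C c m' a = P a - N a) :
    gtd (S.view m) (S.view m') ≤ ∑ a, ((P a).trace.re + (N a).trace.re) := by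
  rw [Finset.sum_add_distrib, ← trace_blockDiagonal_branchState S P,
    ← trace_blockDiagonal_branchState S N, view_hashProtocol, view_hashProtocol]
  refine gtd_le_of_sub_eq (posSemidef_blockDiagonal fun t => posSemidef_branchState S hP _ _)
    (posSemidef_blockDiagonal fun t => posSemidef_branchState S hN _ _) ?_
  refine (Matrix.blockDiagonal_sub _ _).symm.trans
    (Eq.trans (congrArg _ (funext fun t => ?_)) (Matrix.blockDiagonal_sub _ _))
  exact branchState_sub_eq S h t.1.toList t.2.2.toList

/-- The values of a random function at two points are independent. -/
lemma sum_mul_apply_eq_zero {x y : Word n} (hxy : x ≠ y) (φ ψ : Fin K → ℝ) (hφ : ∑ v, φ v = 0) :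
    ∑ F : Word n → Fin K, φ (F x) * ψ (F y) = 0 := by
  -- Adding `b` to the value of `F` at `x` permutes the functions and fixes `F y`; summing over `b`
  -- then replaces `φ (F x)` by the total sum of `φ`, which is zero.
  have h1 : ∀ b : Fin K, ∑ F : Word n → Fin K, φ (F x) * ψ (F y)
      = ∑ F : Word n → Fin K, φ (F x + b) * ψ (F y) := fun b => by
    rw [← Equiv.sum_comp (Equiv.addRight (Pi.single x b : Word n → Fin K))]
    refine Finset.sum_congr rfl fun F _ => ?_
    simp [Pi.single_eq_of_ne hxy.symm]
  have h2 : (K : ℝ) * ∑ F : Word n → Fin K, φ (F x) * ψ (F y) = 0 := by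
    calc (K : ℝ) * ∑ F : Word n → Fin K, φ (F x) * ψ (F y)
        = ∑ b : Fin K, ∑ F : Word n → Fin K, φ (F x + b) * ψ (F y) := by
          rw [← Finset.sum_congr rfl fun b _ => h1 b]; simp
      _ = ∑ F : Word n → Fin K, (∑ b, φ (F x + b)) * ψ (F y) := by
          rw [Finset.sum_comm]; simp only [Finset.sum_mul]
      _ = 0 := Finset.sum_eq_zero fun F _ => by
          
          have h3 := Equiv.sum_comp (Equiv.addLeft (F x)) φ
          simp only [Equiv.coe_addLeft] at h3
          rw [h3, hφ, zero_mul]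
  exact (mul_eq_zero.1 h2).resolve_left (Nat.cast_ne_zero.2 (NeZero.ne K))

/-- For a fixed colour and masked message, the difference is, as a function of the value `F x`,
either zero or a multiple of a difference of two point indicators. It sums to zero over that value,
and `F x` is independent of `F y`. -/
lemma symbolProb_sub_orthogonal (m m' : Fin K) {x y : Word n} (hxy : x ≠ y) :
    ∑ j : Fin Q × (Word n → Fin K) × Fin K,
      (symbolProb C m (Sum.inl j) x - symbolProb C m' (Sum.inl j) x)
        * (symbolProb C m (Sum.inl j) y - symbolProb C m' (Sum.inl j) y) = 0 := by
  rw [Fintype.sum_prod_type]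
  refine Finset.sum_eq_zero fun q _ => ?_
  rw [Fintype.sum_prod_type_right]
  refine Finset.sum_eq_zero fun c _ => ?_
  set u : ℝ := (Fintype.card (Word n → Fin K) : ℝ)⁻¹
  by_cases hx : C x = q
  · refine sum_mul_apply_eq_zero hxy
      (fun v => (if C x = q ∧ v + m = c then u else 0) - (if C x = q ∧ v + m' = c then u else 0))
      (fun v => (if C y = q ∧ v + m = c then u else 0) - (if C y = q ∧ v + m' = c then u else 0)) ?_
    simp only [hx, true_and, Finset.sum_sub_distrib, ← eq_sub_iff_add_eq]
    simp
  · refine Finset.sum_eq_zero fun F _ => ?_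
    simp [symbolProb, hx]

/-- Each probability is `0` or `u`, so the squared difference is at most `u` times their sum, and
each of the two families has total mass one. -/
lemma symbolProb_sub_sq_le (m m' : Fin K) (x : Word n) :
    ∑ j : Fin Q × (Word n → Fin K) × Fin K,
      (symbolProb C m (Sum.inl j) x - symbolProb C m' (Sum.inl j) x)
        * (symbolProb C m (Sum.inl j) x - symbolProb C m' (Sum.inl j) x)
      ≤ 2 * (Fintype.card (Word n → Fin K) : ℝ)⁻¹ := by
  set u : ℝ := (Fintype.card (Word n → Fin K) : ℝ)⁻¹ with hu
  have hu0 : 0 ≤ u := by positivity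
  have hsum : ∀ m : Fin K, ∑ j : Fin Q × (Word n → Fin K) × Fin K,
      symbolProb C m (Sum.inl j) x = 1 := fun m => by
    have h := sum_symbolProb (C := C) m x
    rw [Fintype.sum_sum_type] at h
    simpa [symbolProb] using h
  have hpt : ∀ j : Fin Q × (Word n → Fin K) × Fin K,
      (symbolProb C m (Sum.inl j) x - symbolProb C m' (Sum.inl j) x)
        * (symbolProb C m (Sum.inl j) x - symbolProb C m' (Sum.inl j) x)
      ≤ u * (symbolProb C m (Sum.inl j) x + symbolProb C m' (Sum.inl j) x) := fun j => by
    simp only [symbolProb, ← hu]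
    split_ifs <;> nlinarith
  refine (Finset.sum_le_sum fun j _ => hpt j).trans (le_of_eq ?_)
  rw [← Finset.mul_sum, Finset.sum_add_distrib, hsum, hsum]
  ring

end Protocol

/-- The decomposition of a classical-quantum state with large smooth min-entropy. -/
lemma exists_decomposition {α β : Type} [Fintype α] [DecidableEq α] [Fintype β] [DecidableEq β]
    [Nonempty α] {W : α → Matrix β β ℂ} (hW : ∀ x, IsState (W x)) {ε l : ℝ}
    (h : (l : EReal) ≤ smoothCondMinEntropy ε (uniformJoint W)) :
    ∃ (σ : Matrix β β ℂ) (ρ P N : α → Matrix β β ℂ), σ.PosDef ∧ σ.trace.re = 2 ∧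
      (∀ x, (ρ x).PosSemidef) ∧ (∀ x, (P x).PosSemidef) ∧ (∀ x, (N x).PosSemidef) ∧
      (∀ x, ((((2 : ℝ) ^ (1 - l) : ℝ) : ℂ) • σ - ρ x).PosSemidef) ∧
      ∑ x, (ρ x).trace.re ≤ 1 ∧ ∑ x, ((P x).trace.re + (N x).trace.re) ≤ 2 * ε ∧
      ∀ x, (((Fintype.card α : ℝ)⁻¹ : ℝ) : ℂ) • W x = ρ x - P x + N x := by
  have h1 : ((l - 1 : ℝ) : EReal) < smoothCondMinEntropy ε (uniformJoint W) :=
    lt_of_lt_of_le (EReal.coe_lt_coe_iff.2 (by linarith)) h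
  simp only [smoothCondMinEntropy, lt_iSup_iff] at h1
  obtain ⟨ρ', ⟨⟨hρ', htr'⟩, hgtd⟩, h2⟩ := h1
  simp only [condMinEntropy, lt_iSup_iff] at h2
  obtain ⟨σ, hσ, h3⟩ := h2
  rw [dMax, EReal.lt_neg_comm] at h3
  simp only [iInf_lt_iff] at h3
  obtain ⟨l', hl', hlt⟩ := h3
  rw [← EReal.coe_neg, EReal.coe_lt_coe_iff] at hlt
  -- The dimension must be nonzero for the maximally mixed state to be available below.
  have hβ : Nonempty β := by
    by_contra hempty
    rw [not_nonempty_iff] at hempty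
    have := hσ.2
    rw [Matrix.trace_eq_zero_of_isEmpty] at this
    exact zero_ne_one this
  have hherm : (ρ' - uniformJoint W).IsHermitian := by
    refine hρ'.1.sub (Matrix.IsHermitian.ext fun i j => ?_)
    simp only [uniformJoint, Matrix.of_apply]
    by_cases hij : i.1 = j.1
    · rw [if_pos hij.symm, if_pos hij, star_mul', hij, (hW j.1).1.1.apply]
      congr 1
      simp
    · rw [if_neg fun h => hij h.symm, if_neg hij, star_zero]
  obtain ⟨-, P, N, hP, hN, hPN, htrPN⟩ := exists_sign_and_jordan hherm
  have htr : ∀ R : Matrix (α × β) (α × β) ℂ,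
      ∑ x, (R.submatrix (Prod.mk x) (Prod.mk x)).trace.re = R.trace.re := fun R => by
    simp only [Matrix.trace, Fintype.sum_prod_type, Complex.re_sum]
    rfl
  have hd : (0 : ℝ) < Fintype.card β := Nat.cast_pos.2 Fintype.card_pos
  have hpd : ((((Fintype.card β : ℝ)⁻¹ : ℝ) : ℂ) • (1 : Matrix β β ℂ)).PosDef :=
    Matrix.PosDef.one.smul (by simpa using hd)
  -- Adding the maximally mixed state makes `σ` invertible and raises its trace to two. The smoothed
  -- state `ρ'` need not be classical on the input, but its diagonal blocks suffice.
  refine ⟨σ + (((Fintype.card β : ℝ)⁻¹ : ℝ) : ℂ) • 1, fun x => ρ'.submatrix (Prod.mk x) (Prod.mk x),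
    fun x => P.submatrix (Prod.mk x) (Prod.mk x), fun x => N.submatrix (Prod.mk x) (Prod.mk x),
    hpd.posSemidef_add hσ.1, ?_, fun x => hρ'.submatrix _, fun x => hP.submatrix _,
    fun x => hN.submatrix _, fun x => ?_, ?_, ?_, fun x => ?_⟩
  · rw [Matrix.trace_add, Matrix.trace_smul, Matrix.trace_one, hσ.2]
    simp only [smul_eq_mul, Complex.add_re, Complex.one_re, Complex.re_ofReal_mul,
      Complex.natCast_re, inv_mul_cancel₀ hd.ne']
    norm_num
  · have h4 := hl'.submatrix (Prod.mk x)
    have h5 : (2 : ℝ) ^ l' ≤ 2 ^ (1 - l) :=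
      Real.rpow_le_rpow_of_exponent_le one_le_two (by linarith)
    have h6 : ((((2 : ℝ) ^ (1 - l) - 2 ^ l' : ℝ) : ℂ) • σ).PosSemidef :=
      hσ.1.smul (by rw [Complex.zero_le_real]; linarith)
    have h7 : ((((2 : ℝ) ^ (1 - l) : ℝ) : ℂ) •
        ((((Fintype.card β : ℝ)⁻¹ : ℝ) : ℂ) • (1 : Matrix β β ℂ))).PosSemidef :=
      hpd.posSemidef.smul (by rw [Complex.zero_le_real]; positivity)
    convert (h4.add h6).add h7 using 1
    ext i j
    simp only [Matrix.sub_apply, Matrix.smul_apply, Matrix.add_apply, Matrix.submatrix_apply,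
      Matrix.kronecker, Matrix.kroneckerMap_apply, Matrix.one_apply_eq, smul_eq_mul]
    push_cast
    ring
  · rw [htr]
    exact htr'
  · rw [Finset.sum_add_distrib, htr, htr, htrPN]
    have := norm_nonneg (ρ'.trace - (uniformJoint W).trace)
    rw [gtd] at hgtd
    linarith
  · ext i j
    have h8 := congrFun (congrFun hPN (x, i)) (x, j)
    simp only [Matrix.sub_apply, uniformJoint, Matrix.of_apply, if_true] at h8
    simp only [Matrix.sub_apply, Matrix.smul_apply, Matrix.add_apply, Matrix.submatrix_apply,
      smul_eq_mul]
    push_cast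
    linear_combination -h8

lemma traceNorm_zero_le {ι : Type} [Fintype ι] [DecidableEq ι] :
    traceNorm (0 : Matrix ι ι ℂ) ≤ 0 := by
  simpa using traceNorm_sub_le (Matrix.PosSemidef.zero (n := ι) (R := ℂ)) Matrix.PosSemidef.zero

/-- Each weighted channel output is written as `ρ x - P x + N x`. Leftover hashing treats `ρ`; the
smoothing errors `P`, `N` have total trace at most `2 ε` and enter once for each message, giving `4
ε`. -/
lemma deltaH_hashProtocol_le {n Q K : ℕ} [NeZero K] {C : Word n → Fin Q} {r : ℝ}
    {mod : Model n} {ε l : ℝ} (hmod : ∀ c ∈ mod.bob,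
      (l : EReal) ≤ smoothCondMinEntropy ε (uniformJoint c.W)) :
    (hashProtocol n Q K C r).deltaH mod
      ≤ ENNReal.ofReal (2 * √(Q * K * 2 ^ (1 - l)) + 4 * ε) := by
  refine iSup₂_le fun c hc => iSup_le fun S => iSup₂_le fun m m' => iSup_le fun _ =>
    ENNReal.ofReal_le_ofReal ?_
  obtain ⟨σ, ρ, P, N, hσ, hσtr, hρ, hP, hN, hρσ, hρtr, hPN, hdec⟩ :=
    exists_decomposition c.isState (hmod c hc)
  set b : ℝ := 2 ^ (1 - l) with hb
  have hb0 : 0 < b := by positivity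
  have hQ : 0 < Q := (Nat.zero_le _).trans_lt (C 0).2
  set d : Symbol n Q K → Word n → ℝ := fun a x => symbolProb C m a x - symbolProb C m' a x
  have hherm : ∀ a, (∑ x, (d a x : ℂ) • ρ x).IsHermitian := fun a => by
    rw [Matrix.IsHermitian, Matrix.conjTranspose_sum]
    refine Finset.sum_congr rfl fun x _ => ?_
    rw [Matrix.conjTranspose_smul, (hρ x).1.eq]
    congr 1
    exact Complex.conj_ofReal _
  choose P₀ N₀ hP₀ hN₀ hPN₀ htr₀ using fun a => (exists_sign_and_jordan (hherm a)).2
  have hcomb : ∀ (w : Word n → ℝ) (R : Word n → Matrix c.B c.B ℂ), (∀ x, 0 ≤ w x) →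
      (∀ x, (R x).PosSemidef) → (∑ x, (w x : ℂ) • R x).PosSemidef := fun w R hw hR =>
    Matrix.posSemidef_sum _ fun x _ => (hR x).smul (by rw [Complex.zero_le_real]; exact hw x)
  have htrc : ∀ (w : Word n → ℝ) (R : Word n → Matrix c.B c.B ℂ),
      (∑ x, (w x : ℂ) • R x).trace.re = ∑ x, w x * (R x).trace.re := fun w R => by
    simp only [Matrix.trace_sum, Complex.re_sum, Matrix.trace_smul, smul_eq_mul,
      Complex.re_ofReal_mul]
  have hview := gtd_view_le S m m'
    (P := fun a => P₀ a + (∑ x, (symbolProb C m' a x : ℂ) • P x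
      + ∑ x, (symbolProb C m a x : ℂ) • N x))
    (N := fun a => N₀ a + (∑ x, (symbolProb C m a x : ℂ) • P x
      + ∑ x, (symbolProb C m' a x : ℂ) • N x))
    (fun a => (hP₀ a).add ((hcomb _ _ (symbolProb_nonneg m' a) hP).add
      (hcomb _ _ (symbolProb_nonneg m a) hN)))
    (fun a => (hN₀ a).add ((hcomb _ _ (symbolProb_nonneg m a) hP).add
      (hcomb _ _ (symbolProb_nonneg m' a) hN)))
    (fun a => by
      rw [symbolState, symbolState, ← Finset.sum_sub_distrib]
      simp only [← sub_smul, ← Complex.ofReal_sub, ← sub_mul]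
      have e1 : ∀ x, (((symbolProb C m a x - symbolProb C m' a x)
          * (Fintype.card (Word n) : ℝ)⁻¹ : ℝ) : ℂ) • c.W x = (d a x : ℂ) • ρ x
          + ((symbolProb C m' a x : ℂ) • P x + (symbolProb C m a x : ℂ) • N x)
          - ((symbolProb C m a x : ℂ) • P x + (symbolProb C m' a x : ℂ) • N x) := fun x => by
        rw [Complex.ofReal_mul, mul_smul, hdec x]
        simp only [d, Complex.ofReal_sub, sub_smul, smul_add, smul_sub]
        abel
      rw [Finset.sum_congr rfl fun x _ => e1 x, Finset.sum_sub_distrib, Finset.sum_add_distrib,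
        hPN₀ a, Finset.sum_add_distrib, Finset.sum_add_distrib]
      abel)
  refine hview.trans ?_
  have hsplit : ∀ a, ((P₀ a + (∑ x, (symbolProb C m' a x : ℂ) • P x
      + ∑ x, (symbolProb C m a x : ℂ) • N x)).trace.re
      + (N₀ a + (∑ x, (symbolProb C m a x : ℂ) • P x
      + ∑ x, (symbolProb C m' a x : ℂ) • N x)).trace.re)
      = traceNorm (∑ x, (d a x : ℂ) • ρ x)
        + ∑ x, (symbolProb C m a x + symbolProb C m' a x)
          * ((P x).trace.re + (N x).trace.re) := fun a => by
    rw [← htr₀ a]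
    simp only [Matrix.trace_add, Complex.add_re, htrc]
    have e2 : ∀ x, (symbolProb C m a x + symbolProb C m' a x) * ((P x).trace.re + (N x).trace.re)
        = symbolProb C m' a x * (P x).trace.re + symbolProb C m a x * (N x).trace.re
          + (symbolProb C m a x * (P x).trace.re + symbolProb C m' a x * (N x).trace.re) :=
      fun x => by ring
    simp only [e2, Finset.sum_add_distrib]
    ring
  rw [Finset.sum_congr rfl fun a _ => hsplit a, Finset.sum_add_distrib]
  refine add_le_add ?_ ?_
  · rw [Fintype.sum_sum_type]
    have hinr : ∑ w : Word n, traceNorm (∑ x, (d (Sum.inr w) x : ℂ) • ρ x) ≤ 0 :=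
      Finset.sum_nonpos fun w _ => by
        have : ∑ x, (d (Sum.inr w) x : ℂ) • ρ x = 0 := by simp [d, symbolProb]
        rw [this]
        exact traceNorm_zero_le
    set u : ℝ := (Fintype.card (Word n → Fin K) : ℝ) with hu
    have hu0 : 0 < u := Nat.cast_pos.2 Fintype.card_pos
    have hQ0 : (0 : ℝ) < Q := Nat.cast_pos.2 hQ
    have hK0 : (0 : ℝ) < K := Nat.cast_pos.2 (NeZero.pos K)
    set s : ℝ := √(Q * K * b) with hs
    have hs0 : 0 < s := Real.sqrt_pos.2 (by positivity)
    have hss : s * s = Q * K * b := Real.mul_self_sqrt (by positivity)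
    -- The parameter `t = s / (Q K u)` balances the two terms: there are `Q u K` symbols, the
    -- collision bound is `2 / u`, and the optimum is `2 s`.
    have hlhl := sum_traceNorm_le hσ hb0 ρ hρ hρσ
      (fun (j : Fin Q × (Word n → Fin K) × Fin K) x => d (Sum.inl j) x)
      (symbolProb_sub_sq_le m m') (fun x y => symbolProb_sub_orthogonal m m') (s / (Q * K * u))
    rw [hσtr, ← hu] at hlhl
    have hcard : (Fintype.card (Fin Q × (Word n → Fin K) × Fin K) : ℝ) = Q * (u * K) := by
      simp only [Fintype.card_prod, Fintype.card_fin, hu]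
      push_cast
      ring
    rw [hcard] at hlhl
    have h1 : 2 * u⁻¹ * (b * ∑ x, (ρ x).trace.re) ≤ 2 * u⁻¹ * b := by
      refine mul_le_mul_of_nonneg_left ?_ (by positivity)
      exact mul_le_of_le_one_right hb0.le hρtr
    set X := ∑ j : Fin Q × (Word n → Fin K) × Fin K,
      traceNorm (∑ x, (d (Sum.inl j) x : ℂ) • ρ x)
    have h2 : (2 * (s / (Q * K * u))) * X ≤ (2 * (s / (Q * K * u))) * (2 * s) := by
      have e3 : (s / (Q * K * u)) ^ 2 * (Q * (u * K)) * 2 = 2 * (b / u) := by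
        field_simp
        linear_combination hss
      have e4 : 2 * (s / (Q * K * u)) * (2 * s) = 4 * (b / u) := by
        field_simp
        linear_combination 4 * hss
      have e5 : 2 * u⁻¹ * b = 2 * (b / u) := by field_simp
      linarith
    have h3 := le_of_mul_le_mul_left h2 (by positivity)
    linarith
  · rw [Finset.sum_comm]
    simp only [← Finset.sum_mul, Finset.sum_add_distrib, sum_symbolProb]
    rw [← Finset.mul_sum]
    linarith

/-! ### The binary symmetric channels are admissible -/

lemma tendsto_exp_nat_mul {u : ℕ → ℝ} {c : ℝ} (hc : c < 0) (hu : Tendsto u atTop (𝓝 c)) :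
    Tendsto (fun n : ℕ => Real.exp (n * u n)) atTop (𝓝 0) :=
  Real.tendsto_exp_atBot.comp (tendsto_natCast_atTop_atTop.atTop_mul_neg hc hu)

/-- With `t = n ^ (-1/2)` and a slack of `n ^ (3/4)` bits, the tail exponent is `κ² - n ^ (1/4) log
2`, which tends to `-∞`, while the slack is `o(n)`. -/
lemma exists_typical (p : unitInterval) :
    ∃ ε l : ℕ → ℝ, (∀ n, 0 ≤ ε n) ∧ (∀ n, 0 ≤ l n) ∧ Tendsto ε atTop (𝓝 0) ∧
      Tendsto (fun n => l n / n) atTop (𝓝 (h p)) ∧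
      ∀ n, ∀ x : Word n, ∑ z with (2 : ℝ) ^ (-l n) < bscW p x z, bscW p x z ≤ ε n := by
  have hle1 : ∀ n (x z : Word n), bscW p x z ≤ 1 := fun n x z => bscW_le_one p.2.1 p.2.2 x z
  by_cases hp : (p : ℝ) = 0 ∨ (p : ℝ) = 1
  -- A deterministic channel has entropy zero, and no probability exceeds `2 ^ 0`.
  · refine ⟨fun _ => 0, fun _ => 0, fun _ => le_rfl, fun _ => le_rfl, tendsto_const_nhds, ?_,
      fun n x => ?_⟩
    · have : h p = 0 := by rcases hp with hp | hp <;> simp [h, hp]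
      simp [this]
    · rw [Finset.filter_false_of_mem fun z _ => by simpa using hle1 n x z, Finset.sum_empty]
  push Not at hp
  have hp0 : (0 : ℝ) < p := lt_of_le_of_ne p.2.1 hp.1.symm
  have hp1 : (p : ℝ) < 1 := lt_of_le_of_ne p.2.2 hp.2
  set κ : ℝ := Real.log p - Real.log (1 - p) with hκ
  set t : ℕ → ℝ := fun n => (n : ℝ) ^ (-(1 / 2) : ℝ) with ht
  set u : ℕ → ℝ := fun n => (n : ℝ) ^ (3 / 4 : ℝ) * Real.log 2 with hu
  have htlim : Tendsto (fun n => κ * t n) atTop (𝓝 0) := by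
    have h1 := ((tendsto_rpow_neg_atTop (by norm_num : (0 : ℝ) < 1 / 2)).comp
      tendsto_natCast_atTop_atTop).const_mul κ
    rwa [mul_zero] at h1
  have htu : Tendsto (fun n => t n * u n) atTop atTop := by
    have h1 : Tendsto (fun n : ℕ => (n : ℝ) ^ (1 / 4 : ℝ) * Real.log 2) atTop atTop :=
      ((tendsto_rpow_atTop (by norm_num)).comp tendsto_natCast_atTop_atTop).atTop_mul_const
        log_two_pos
    refine h1.congr' ?_
    filter_upwards [eventually_gt_atTop 0] with n hn
    have hn' : (0 : ℝ) < n := Nat.cast_pos.2 hn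
    simp only [ht, hu]
    rw [← mul_assoc, ← Real.rpow_add hn']
    norm_num
  have hev : ∀ᶠ n : ℕ in atTop, 0 < n ∧ |κ * t n| ≤ 1 := by
    refine (eventually_gt_atTop 0).and ?_
    have := htlim.abs
    rw [abs_zero] at this
    exact (this.eventually (gt_mem_nhds one_pos)).mono fun n hn => hn.le
  classical
  -- For the finitely many `n` outside the range of the tail bound the trivial value `1` is used.
  -- The maximum with `0` keeps `l n` nonnegative, as `Params` requires.
  refine ⟨fun n => if 0 < n ∧ |κ * t n| ≤ 1 then Real.exp (κ ^ 2 - t n * u n) else 1,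
    fun n => max 0 (n * h p - (n : ℝ) ^ (3 / 4 : ℝ)), fun n => ?_, fun n => le_max_left _ _, ?_, ?_,
    fun n x => ?_⟩
  · change 0 ≤ ite _ _ _
    split_ifs <;> positivity
  · have h1 : Tendsto (fun n => Real.exp (κ ^ 2 - t n * u n)) atTop (𝓝 0) :=
      Real.tendsto_exp_atBot.comp (tendsto_atBot_add_const_left _ _
        (tendsto_neg_atTop_atBot.comp htu))
    refine h1.congr' (hev.mono fun n hn => ?_)
    exact (if_pos hn).symm
  · have h1 : Tendsto (fun n : ℕ => max 0 (h p - (n : ℝ) ^ (-(1 / 4) : ℝ))) atTop (𝓝 (h p)) := by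
      have h2 : Tendsto (fun n : ℕ => h p - (n : ℝ) ^ (-(1 / 4) : ℝ)) atTop (𝓝 (h p - 0)) :=
        tendsto_const_nhds.sub ((tendsto_rpow_neg_atTop (by norm_num)).comp
          tendsto_natCast_atTop_atTop)
      have h3 := (tendsto_const_nhds (x := (0 : ℝ))).max h2
      rwa [sub_zero, max_eq_right (h_nonneg p.2.1 p.2.2)] at h3
    refine h1.congr' ?_
    filter_upwards [eventually_gt_atTop 0] with n hn
    have hn' : (0 : ℝ) < n := Nat.cast_pos.2 hn
    rw [← max_div_div_right hn'.le, zero_div, sub_div, mul_div_cancel_left₀ _ hn'.ne']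
    congr 2
    rw [show (-(1 / 4) : ℝ) = 3 / 4 - 1 by norm_num, Real.rpow_sub hn', Real.rpow_one]
  · change ∑ z with (2 : ℝ) ^ (-max 0 (n * h p - (n : ℝ) ^ (3 / 4 : ℝ))) < bscW p x z,
        bscW p x z ≤ ite _ _ _
    have hsum1 : ∑ z with (2 : ℝ) ^ (-max 0 (n * h p - (n : ℝ) ^ (3 / 4 : ℝ))) < bscW p x z,
        bscW p x z ≤ 1 := by
      rw [← sum_bscW p x]
      exact Finset.sum_le_sum_of_subset_of_nonneg (Finset.filter_subset _ _) fun z _ _ =>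
        bscW_nonneg p.2.1 p.2.2 x z
    split_ifs with hn
    · have hn' : (0 : ℝ) < n := Nat.cast_pos.2 hn.1
      rcases le_total (n * h p - (n : ℝ) ^ (3 / 4 : ℝ)) 0 with hneg | hpos
      · rw [max_eq_left hneg, Finset.filter_false_of_mem fun z _ => by simpa using hle1 n x z,
          Finset.sum_empty]
        positivity
      · rw [max_eq_right hpos]
        have h1 := sum_bscW_atypical_le hp0 hp1 (t := t n) (u := u n) (by positivity) hn.2 x
        have e1 : Real.exp (u n - n * Real.binEntropy p)
            = 2 ^ (-(n * h p - (n : ℝ) ^ (3 / 4 : ℝ))) := by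
          rw [Real.rpow_def_of_pos two_pos, ← h_mul_log_two]
          congr 1
          simp only [hu]
          ring
        have e2 : (n : ℝ) * (κ * t n) ^ 2 = κ ^ 2 := by
          have : t n ^ 2 = (n : ℝ)⁻¹ := by
            simp only [ht]
            rw [← Real.rpow_natCast, ← Real.rpow_mul hn'.le, ← Real.rpow_neg_one]
            norm_num
          rw [mul_pow, this]
          field_simp
        rwa [e1, ← hκ, e2] at h1
    · exact hsum1

lemma sum_filter_not_le_eq {α : Type} [Fintype α] (f : α → ℝ) (b : ℝ) :
    ∑ z, (f z - if f z ≤ b then f z else 0) = ∑ z with b < f z, f z := by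
  rw [Finset.sum_filter]
  refine Finset.sum_congr rfl fun z _ => ?_
  by_cases hz : f z ≤ b
  · rw [if_pos hz, if_neg (not_lt.2 hz), sub_self]
  · rw [if_neg hz, if_pos (not_le.1 hz), sub_zero]

/-- Delete the outputs of probability above `2 ^ (-l)`. The lost mass bounds both halves of the
generalized distance. -/
lemma le_smoothMinEntropy_bsc {n : ℕ} (p : unitInterval) (x : Word n) {ε l : ℝ}
    (hε : ∑ z with (2 : ℝ) ^ (-l) < bscW p x z, bscW p x z ≤ ε) :
    (l : EReal) ≤ smoothMinEntropy ε fun z => (bsc n p x z).toReal := by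
  simp only [bsc_toReal]
  have h0 := fun z => bscW_nonneg p.2.1 p.2.2 x z
  set R : Word n → ℝ := fun z => if bscW p x z ≤ 2 ^ (-l) then bscW p x z else 0 with hR
  have hR0 : ∀ z, 0 ≤ R z := fun z => by
    simp only [hR]
    split_ifs
    exacts [h0 z, le_rfl]
  have hRle : ∀ z, R z ≤ bscW p x z := fun z => by
    simp only [hR]
    split_ifs
    exacts [le_rfl, h0 z]
  have hdiff := sum_filter_not_le_eq (bscW p x) (2 ^ (-l))
  refine le_trans ?_ (le_iSup₂ (f := fun (R : Word n → ℝ) (_ : (∀ x, 0 ≤ R x) ∧ ∑ x, R x ≤ 1 ∧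
    gtdClassical R (fun z => bscW p x z) ≤ ε) => minEntropy R) R ⟨hR0, ?_, ?_⟩)
  · rw [minEntropy, EReal.le_neg, ← EReal.coe_neg]
    refine iInf₂_le (-l) fun z => ?_
    simp only [hR]
    split_ifs with hz
    · exact hz
    · positivity
  · rw [← sum_bscW p x]
    exact Finset.sum_le_sum fun z _ => hRle z
  · have h1 : ∑ z, |R z - bscW p x z| = ∑ z with (2 : ℝ) ^ (-l) < bscW p x z, bscW p x z := by
      rw [← hdiff]
      refine Finset.sum_congr rfl fun z _ => ?_
      rw [abs_sub_comm, abs_of_nonneg (sub_nonneg.2 (hRle z))]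
    have h2 := Finset.abs_sum_le_sum_abs (fun z => R z - bscW p x z) Finset.univ
    rw [gtdClassical]
    linarith

lemma uniformJoint_diagonal {α β : Type} [Fintype α] [DecidableEq α] [DecidableEq β]
    (f : α → β → ℝ) :
    uniformJoint (fun x => Matrix.diagonal fun z => (f x z : ℂ))
      = Matrix.diagonal fun i => (((Fintype.card α : ℝ)⁻¹ * f i.1 i.2 : ℝ) : ℂ) := by
  ext i j
  simp only [uniformJoint, Matrix.of_apply, Matrix.diagonal_apply, Prod.ext_iff]
  by_cases h1 : i.1 = j.1 <;> by_cases h2 : i.2 = j.2 <;> simp [h1, h2]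

/-- The same truncation, with the maximally mixed state as conditioning state. Input and output
share the alphabet, so the uniform input weight equals the weight of that state, and a bound on
transition probabilities becomes one on the uncertainty of the input given the output. -/
lemma le_smoothCondMinEntropy_diagonal {α : Type} [Fintype α] [DecidableEq α] [Nonempty α]
    {f : α → α → ℝ} (h0 : ∀ x z, 0 ≤ f x z) (h1 : ∀ x, ∑ z, f x z ≤ 1) {ε l : ℝ}
    (hε : ∀ x, ∑ z with (2 : ℝ) ^ (-l) < f x z, f x z ≤ ε) :
    (l : EReal) ≤ smoothCondMinEntropy ε
      (uniformJoint fun x => Matrix.diagonal fun z => (f x z : ℂ)) := by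
  rw [uniformJoint_diagonal]
  set u : ℝ := (Fintype.card α : ℝ)⁻¹ with hu
  have hu0 : 0 ≤ u := by positivity
  have hcard : (Fintype.card α : ℝ) * u = 1 :=
    mul_inv_cancel₀ (Nat.cast_ne_zero.2 Fintype.card_ne_zero)
  set R : α → α → ℝ := fun x z => if f x z ≤ 2 ^ (-l) then f x z else 0 with hR
  have hR0 : ∀ x z, 0 ≤ R x z := fun x z => by
    simp only [hR]
    split_ifs
    exacts [h0 x z, le_rfl]
  have hRle : ∀ x z, R x z ≤ f x z := fun x z => by
    simp only [hR]
    split_ifs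
    exacts [le_rfl, h0 x z]
  have hRb : ∀ x z, R x z ≤ 2 ^ (-l) := fun x z => by
    simp only [hR]
    split_ifs with hz
    · exact hz
    · positivity
  have hpsd : ∀ f : α → α → ℝ, (∀ x z, 0 ≤ f x z) →
      (Matrix.diagonal fun i : α × α => ((u * f i.1 i.2 : ℝ) : ℂ)).PosSemidef :=
    fun f hf => Matrix.PosSemidef.diagonal fun i => by
      rw [Pi.zero_apply, Complex.zero_le_real]
      exact mul_nonneg hu0 (hf _ _)
  have htr : ∀ (f : α → α → ℝ) (b : ℝ), (∀ x, ∑ z, f x z ≤ b) →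
      (Matrix.diagonal fun i : α × α => ((u * f i.1 i.2 : ℝ) : ℂ)).trace.re ≤ b :=
    fun f b hf => by
      rw [Matrix.trace_diagonal, ← Complex.ofReal_sum, Complex.ofReal_re, ← Finset.mul_sum,
        Fintype.sum_prod_type]
      calc u * ∑ x, ∑ z, f x z ≤ u * ∑ _x : α, b :=
            mul_le_mul_of_nonneg_left (Finset.sum_le_sum fun x _ => hf x) hu0
        _ = b := by
            rw [Finset.sum_const, Finset.card_univ, nsmul_eq_mul, ← mul_assoc, mul_comm u, hcard,
              one_mul]
  have hgtd : gtd (Matrix.diagonal fun i : α × α => ((u * R i.1 i.2 : ℝ) : ℂ))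
      (Matrix.diagonal fun i : α × α => ((u * f i.1 i.2 : ℝ) : ℂ)) ≤ ε := by
    refine (gtd_le_of_sub_eq Matrix.PosSemidef.zero
      (hpsd (fun x z => f x z - R x z) fun x z => sub_nonneg.2 (hRle x z)) ?_).trans ?_
    · rw [zero_sub, Matrix.diagonal_sub, Matrix.diagonal_neg]
      congr 1
      funext i
      push_cast
      ring
    · rw [Matrix.trace_zero, Complex.zero_re, zero_add]
      exact htr _ ε fun x => (sum_filter_not_le_eq (f x) (2 ^ (-l))).trans_le (hε x)
  have hstate : IsState (Matrix.diagonal fun _ : α => (u : ℂ)) := by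
    refine ⟨Matrix.PosSemidef.diagonal fun z => ?_, ?_⟩
    · rw [Pi.zero_apply, Complex.zero_le_real]
      exact hu0
    · rw [Matrix.trace_diagonal, Finset.sum_const, Finset.card_univ, nsmul_eq_mul]
      exact_mod_cast hcard
  have hdom : ((((2 : ℝ) ^ (-l) : ℝ) : ℂ) • Matrix.kronecker (1 : Matrix α α ℂ)
      (Matrix.diagonal fun _ : α => (u : ℂ))
      - Matrix.diagonal fun i : α × α => ((u * R i.1 i.2 : ℝ) : ℂ)).PosSemidef := by
    have h2 : (((2 : ℝ) ^ (-l) : ℝ) : ℂ) • Matrix.kronecker (1 : Matrix α α ℂ)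
        (Matrix.diagonal fun _ : α => (u : ℂ))
        - Matrix.diagonal (fun i : α × α => ((u * R i.1 i.2 : ℝ) : ℂ))
        = Matrix.diagonal fun i : α × α => ((u * (2 ^ (-l) - R i.1 i.2) : ℝ) : ℂ) := by
      have h3 : Matrix.kronecker (1 : Matrix α α ℂ) (Matrix.diagonal fun _ : α => (u : ℂ))
          = Matrix.diagonal fun _ : α × α => (u : ℂ) := by
        rw [← Matrix.diagonal_one]
        exact (Matrix.diagonal_kronecker_diagonal _ _).trans (by simp)
      rw [h3, ← Matrix.diagonal_smul, Matrix.diagonal_sub]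
      congr 1
      funext i
      simp only [Pi.smul_apply, smul_eq_mul]
      rw [← Complex.ofReal_mul, ← Complex.ofReal_sub]
      congr 1
      ring
    rw [h2]
    exact hpsd (fun x z => 2 ^ (-l) - R x z) fun x z => sub_nonneg.2 (hRb x z)
  refine le_trans (le_trans ?_ (le_iSup₂_of_le (f := fun (σ : Matrix α α ℂ) (_ : IsState σ) =>
      -dMax _ (Matrix.kronecker (1 : Matrix α α ℂ) σ)) _ hstate le_rfl))
    (le_iSup₂_of_le (f := fun (ρ' : Matrix (α × α) (α × α) ℂ) (_ : IsSubState ρ' ∧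
      gtd ρ' _ ≤ ε) => condMinEntropy ρ') _ ⟨⟨hpsd R hR0, htr R 1 fun x =>
        (Finset.sum_le_sum fun z _ => hRle x z).trans (h1 x)⟩, hgtd⟩ le_rfl)
  rw [dMax, EReal.le_neg, ← EReal.coe_neg]
  exact iInf₂_le (-l) hdom

lemma le_smoothCondMinEntropy_bscBob {n : ℕ} (p : unitInterval) {ε l : ℝ}
    (hε : ∀ x : Word n, ∑ z with (2 : ℝ) ^ (-l) < bscW p x z, bscW p x z ≤ ε) :
    (l : EReal) ≤ smoothCondMinEntropy ε (uniformJoint (bscBob n p).W) := by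
  have h := le_smoothCondMinEntropy_diagonal (fun x z => bscW_nonneg p.2.1 p.2.2 x z)
    (fun x => (sum_bscW p x).le) hε
  simp only [← bsc_toReal] at h
  exact h

/-! ### Achievability -/

lemma Achievable.mono {mod mod' : ∀ n, Model n} {R : ℝ} (h : Achievable mod R)
    (hhonest : ∀ n, (mod' n).honest = (mod n).honest) (halice : ∀ n, (mod' n).alice ⊆ (mod n).alice)
    (hbob : ∀ n, (mod' n).bob ⊆ (mod n).bob) : Achievable mod' R := by
  intro R' h0 hR'
  obtain ⟨K, Φ, hK, hC, hH, hB, hlim⟩ := h R' h0 hR'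
  refine ⟨K, Φ, hK, ?_, ?_, ?_, hlim⟩
  · simpa only [Protocol.deltaC, hhonest] using hC
  · exact tendsto_of_tendsto_of_tendsto_of_le_of_le tendsto_const_nhds hH (fun _ => zero_le)
      fun n => biSup_mono fun c hc => hbob n hc
  · exact tendsto_of_tendsto_of_tendsto_of_le_of_le tendsto_const_nhds hB (fun _ => zero_le)
      fun n => biSup_mono fun c hc => halice n hc

/-- The supporting line at `σ₀` lies strictly below its starting value at `σ`. Working with the line
rather than `g` allows `σ > p`, which is needed when `σ₀ = p`. -/
lemma exists_tilt_lt {p σ₀ σ : ℝ} (hp : p < 1 / 2) (h0 : 0 ≤ σ₀) (h1 : σ₀ ≤ p) (h2 : σ₀ < σ) :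
    ∃ s, 0 < s ∧ s < 1 / 2 ∧ tilt p s σ < g p σ₀ * Real.log 2 := by
  rcases h1.eq_or_lt with rfl | h1
  -- At `σ₀ = p` the optimal parameter would be `0`. A tiny `s` loses at most `log 2` at `σ₀`, while
  -- its slope lowers the value at `σ` by at least `log 2 + 1`.
  · set s : ℝ := Real.exp (-((Real.log 2 + 1) / (σ - σ₀))) / 4 with hs
    have hd : 0 < σ - σ₀ := sub_pos.2 h2
    have hs0 : 0 < s := by positivity
    have hs1 : s ≤ 1 / 4 := by
      have : Real.exp (-((Real.log 2 + 1) / (σ - σ₀))) ≤ 1 := by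
        rw [Real.exp_le_one_iff, neg_nonpos]
        have := log_two_pos
        positivity
      rw [hs]
      linarith
    refine ⟨s, hs0, by linarith, ?_⟩
    have h3 := tilt_sub σ₀ hs0 (by linarith) σ₀ σ
    have h4 : Real.log (4 * (s * (1 - s))) ≤ -((Real.log 2 + 1) / (σ - σ₀)) := by
      rw [← Real.log_exp (-((Real.log 2 + 1) / (σ - σ₀)))]
      refine Real.log_le_log (by nlinarith) ?_
      have : Real.exp (-((Real.log 2 + 1) / (σ - σ₀))) = 4 * s := by rw [hs]; ring
      rw [this]
      nlinarith
    have h5 := mul_le_mul_of_nonneg_left h4 hd.le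
    rw [mul_neg, mul_div_cancel₀ _ hd.ne'] at h5
    have h6 : -Real.log 2 ≤ Real.log (1 - s) := by
      rw [← Real.log_inv]
      exact Real.log_le_log (by norm_num) (by norm_num; linarith)
    have h7 : tilt σ₀ s σ₀ = 2 * σ₀ * Real.log 2 - (1 - 2 * σ₀) * Real.log (1 - s) := by
      rw [tilt]; ring
    have h8 : Real.log (1 - s) ≤ 0 := Real.log_nonpos (by linarith) (by linarith)
    rw [g_self]
    nlinarith
  · have hσ' : 0 < 1 - 2 * σ₀ := by linarith
    have hs0 : 0 < (p - σ₀) / (1 - 2 * σ₀) := div_pos (by linarith) hσ'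
    have hs1 : (p - σ₀) / (1 - 2 * σ₀) < 1 / 2 := by rw [div_lt_iff₀ hσ']; linarith
    refine ⟨_, hs0, hs1, ?_⟩
    have h3 := tilt_sub p hs0 (by linarith) σ₀ σ
    have h4 := mul_neg_of_pos_of_neg (sub_pos.2 h2) (log_four_mul_neg hs0 hs1)
    rw [g_mul_log_two p hσ'.ne']
    linarith

lemma tendsto_logb_ceil_div {R : ℝ} (hR : 0 ≤ R) :
    Tendsto (fun n : ℕ => Real.logb 2 (⌈(2 : ℝ) ^ (n * R)⌉₊ : ℕ) / n) atTop (𝓝 R) := by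
  have h1 : Tendsto (fun n : ℕ => R + 1 / (n : ℝ)) atTop (𝓝 R) := by
    simpa using tendsto_const_nhds.add (tendsto_one_div_atTop_nhds_zero_nat (𝕜 := ℝ))
  refine tendsto_of_tendsto_of_tendsto_of_le_of_le' tendsto_const_nhds h1 ?_ ?_
  all_goals
    filter_upwards [eventually_gt_atTop 0] with n hn
    have hn' : (0 : ℝ) < n := Nat.cast_pos.2 hn
    have hpos : (0 : ℝ) < 2 ^ (n * R) := by positivity
    have hceil := Nat.le_ceil ((2 : ℝ) ^ (n * R))
  · rw [le_div_iff₀ hn', Real.le_logb_iff_rpow_le one_lt_two (hpos.trans_le hceil), mul_comm]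
    exact hceil
  · rw [div_le_iff₀ hn', Real.logb_le_iff_le_rpow one_lt_two (hpos.trans_le hceil)]
    have h2 : (R + 1 / n) * n = n * R + 1 := by field_simp
    have h3 := (Nat.ceil_lt_add_one hpos.le).le
    have h4 : (1 : ℝ) ≤ 2 ^ (n * R) := Real.one_le_rpow one_le_two (by positivity)
    rw [h2, Real.rpow_add two_pos, Real.rpow_one]
    linarith

lemma tendsto_zero_of_le_ofReal {f : ℕ → ℝ≥0∞} {b : ℕ → ℝ} (hb : Tendsto b atTop (𝓝 0))
    (h : ∀ᶠ n in atTop, f n ≤ ENNReal.ofReal (b n)) : Tendsto f atTop (𝓝 0) := by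
  have h1 := ENNReal.tendsto_ofReal hb
  rw [ENNReal.ofReal_zero] at h1
  exact tendsto_of_tendsto_of_tendsto_of_le_of_le' tendsto_const_nhds h1
    (Eventually.of_forall fun _ => zero_le) h

/-- Achievability for sequences of unstructured noisy channels. -/
theorem achievable_usnc {p pA pB : unitInterval} (hp : (p : ℝ) < 1 / 2)
    (h1 : 2 * (p : ℝ) ≤ h pA) (h2 : h pA ≤ h p) (h3 : 2 * gInv p (h pA) ≤ 1 / 2)
    {θ : ℕ → Params} (hθ : ∀ n, (θ n).p = p)
    (hεA : Tendsto (fun n => (θ n).εA) atTop (𝓝 0)) (hεB : Tendsto (fun n => (θ n).εB) atTop (𝓝 0))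
    (hlA : Tendsto (fun n => (θ n).lA / n) atTop (𝓝 (h pA)))
    (hlB : Tendsto (fun n => (θ n).lB / n) atTop (𝓝 (h pB))) :
    Achievable (fun n => usnc n (θ n)) (rate p pA pB) := by
  intro R hR0 hR
  have hp0 : (0 : ℝ) ≤ p := p.2.1
  set σ₀ := gInv p (h pA) with hσ₀
  have hmem : σ₀ ∈ Set.Icc 0 (p : ℝ) := gInv_mem hp0 hp h1 h2
  have hg : g p σ₀ = h pA := g_gInv hp0 hp h1 h2
  have hR1 : h (2 * σ₀) < h pB - R := by rw [rate] at hR; linarith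
  -- Equality would force `h pB - R > 1`, impossible for `R ≥ 0`.
  have hlt : 2 * σ₀ < 1 / 2 := by
    refine lt_of_le_of_ne h3 fun heq => ?_
    rw [heq, h_half] at hR1
    linarith [h_le_one (pB : ℝ)]
  obtain ⟨σ, hσ, hσ2, hσh⟩ : ∃ σ, σ₀ < σ ∧ 2 * σ < 1 / 2 ∧ h (2 * σ) < h pB - R := by
    have hc1 : ∀ᶠ σ in 𝓝 σ₀, 2 * σ < 1 / 2 :=
      (continuous_const.mul continuous_id).continuousAt.eventually_lt continuousAt_const hlt
    have hc2 : ∀ᶠ σ in 𝓝 σ₀, h (2 * σ) < h pB - R :=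
      (continuous_h.comp (continuous_const.mul continuous_id)).continuousAt.eventually_lt
        continuousAt_const hR1
    have hc3 : ∀ᶠ σ in 𝓝[>] σ₀, σ₀ < σ := self_mem_nhdsWithin
    obtain ⟨σ, ha, hb, hc⟩ :=
      (hc3.and ((hc1.filter_mono nhdsWithin_le_nhds).and (hc2.filter_mono nhdsWithin_le_nhds))).exists
    exact ⟨σ, ha, hb, hc⟩
  have hσ0 : 0 < σ := hmem.1.trans_lt hσ
  obtain ⟨s, hs0, hs1, hs⟩ := exists_tilt_lt hp hmem.1 hmem.2 hσ
  rw [hg] at hs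
  set G : ℝ := h pA * Real.log 2 - tilt p s σ with hG
  have hG0 : 0 < G := sub_pos.2 hs
  set L : ℝ := Real.log (1 - s) - Real.log s with hL
  have hL0 : 0 ≤ L := sub_nonneg.2 (Real.log_le_log hs0 (by linarith))
  -- Enlarging the radius from `p n` to `(p + δ) n` adds `δ L` to the exponent; this choice spends
  -- at most half of the gap `G`. The bound `δ ≤ 1` serves the Chernoff estimate.
  set δ : ℝ := min 1 (G / (2 * (L + 1))) with hδ
  have hδ0 : 0 < δ := lt_min one_pos (by positivity)
  have hδ1 : δ ≤ 1 := min_le_left _ _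
  have hδL : δ * L ≤ G / 2 := by
    have h4 : δ * (L + 1) ≤ G / (2 * (L + 1)) * (L + 1) :=
      mul_le_mul_of_nonneg_right (min_le_right _ _) (by linarith)
    have h5 : G / (2 * (L + 1)) * (L + 1) = G / 2 := by field_simp
    nlinarith
  choose Q C hQ hC using fun n => exists_separating_coloring n (τ := 2 * σ) (by linarith) hσ2.le
  set K : ℕ → ℕ := fun n => ⌈(2 : ℝ) ^ (n * R)⌉₊ with hK
  have hKpos : ∀ n, 0 < K n := fun n => Nat.ceil_pos.2 (by positivity)
  have hKne : ∀ n, NeZero (K n) := fun n => ⟨(hKpos n).ne'⟩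
  refine ⟨K, fun n => hashProtocol n (Q n) (K n) (C n) ((p + δ) * n), hKpos, ?_, ?_, ?_,
    tendsto_logb_ceil_div hR0⟩
  · refine tendsto_zero_of_le_ofReal (b := fun n : ℕ => Real.exp (n * -(δ ^ 2 / 4)))
      (tendsto_exp_nat_mul (neg_lt_zero.2 (by positivity)) tendsto_const_nhds)
      (Eventually.of_forall fun n => ?_)
    refine deltaC_hashProtocol_le (p := p) (congrArg (bsc n) (hθ n)) fun x => ?_
    rw [show (n : ℝ) * -(δ ^ 2 / 4) = -(δ ^ 2 / 4 * n) by ring]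
    exact sum_bscW_errors_le hp0 p.2.2 hδ0 hδ1 x
  · have hlim : Tendsto (fun n : ℕ => 2 * √(4 * Real.exp
        (n * (Real.log 2 * (h (2 * σ) + R - (θ n).lB / n)))) + 4 * (θ n).εB) atTop (𝓝 0) := by
      have h4 : Tendsto (fun n : ℕ => Real.log 2 * (h (2 * σ) + R - (θ n).lB / n)) atTop
          (𝓝 (Real.log 2 * (h (2 * σ) + R - h pB))) :=
        (tendsto_const_nhds.sub hlB).const_mul _
      have h5 := tendsto_exp_nat_mul (mul_neg_of_pos_of_neg log_two_pos (by linarith)) h4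
      simpa using (((h5.const_mul 4).sqrt).const_mul 2).add (hεB.const_mul 4)
    refine tendsto_zero_of_le_ofReal hlim ?_
    filter_upwards [eventually_gt_atTop 0] with n hn
    have hn' : (n : ℝ) ≠ 0 := (Nat.cast_pos.2 hn).ne'
    refine (deltaH_hashProtocol_le (mod := usnc n (θ n)) (ε := (θ n).εB) (l := (θ n).lB) fun c hc => hc).trans
      (ENNReal.ofReal_le_ofReal ?_)
    have h4 : (K n : ℝ) ≤ 2 * 2 ^ (n * R) := by
      have h6 := (Nat.ceil_lt_add_one (by positivity : (0 : ℝ) ≤ 2 ^ (n * R))).le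
      have h7 : (1 : ℝ) ≤ 2 ^ (n * R) := Real.one_le_rpow one_le_two (by positivity)
      simp only [hK]
      linarith
    -- The constant `4` collects a factor `2` from rounding up the number of messages and a factor
    -- `2` from the bit lost in smoothing.
    have h5 : (Q n : ℝ) * K n * 2 ^ (1 - (θ n).lB)
        ≤ 4 * Real.exp (n * (Real.log 2 * (h (2 * σ) + R - (θ n).lB / n))) := by
      calc (Q n : ℝ) * K n * 2 ^ (1 - (θ n).lB)
          ≤ 2 ^ (n * h (2 * σ)) * (2 * 2 ^ (n * R)) * 2 ^ (1 - (θ n).lB) :=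
            mul_le_mul_of_nonneg_right (mul_le_mul (hQ n) h4 (by positivity) (by positivity))
              (by positivity)
        _ = _ := by
            rw [Real.rpow_sub two_pos, Real.rpow_one]
            have e1 : (n : ℝ) * (Real.log 2 * (h (2 * σ) + R - (θ n).lB / n))
                = Real.log 2 * (n * h (2 * σ)) + Real.log 2 * (n * R)
                  - Real.log 2 * (θ n).lB := by field_simp
            rw [e1, Real.exp_sub, Real.exp_add, ← Real.rpow_def_of_pos two_pos,
              ← Real.rpow_def_of_pos two_pos, ← Real.rpow_def_of_pos two_pos]
            ring
    have := Real.sqrt_le_sqrt h5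
    linarith
  · have hlim : Tendsto (fun n : ℕ => 2 * Real.exp
        (n * (Real.log 2 * (h pA - (θ n).lA / n) - G / 2)) + 2 * (θ n).εA) atTop (𝓝 0) := by
      have h4 : Tendsto (fun n : ℕ => Real.log 2 * (h pA - (θ n).lA / n) - G / 2) atTop
          (𝓝 (Real.log 2 * (h pA - h pA) - G / 2)) :=
        ((tendsto_const_nhds.sub hlA).const_mul _).sub_const _
      have h5 := tendsto_exp_nat_mul (by rw [sub_self, mul_zero]; linarith) h4
      simpa using (h5.const_mul 2).add (hεA.const_mul 2)
    refine tendsto_zero_of_le_ofReal hlim ?_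
    filter_upwards [eventually_gt_atTop 0] with n hn
    have hn' : (0 : ℝ) < n := Nat.cast_pos.2 hn
    refine deltaB_hashProtocol_le fun c hc i x y hxy hne => ?_
    have hset : {z : Word n | (hammingDist x z : ℝ) ≤ (p + δ) * n ∧
        (hammingDist y z : ℝ) ≤ (p + δ) * n} = ↑(Finset.univ.filter fun z : Word n =>
        (hammingDist x z : ℝ) ≤ (p + δ) * n ∧ (hammingDist y z : ℝ) ≤ (p + δ) * n) := by
      ext z; simp
    rw [hset, toOuterMeasure_finset_eq]
    refine ENNReal.ofReal_le_ofReal ((sum_le_of_le_smoothMinEntropy (hc i) _).trans ?_)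
    refine add_le_add_left ?_ _
    refine (mul_le_mul_of_nonneg_right (card_inter_balls_le hs0 hs1.le x y ((p + δ) * n)
      (hC n x y hxy hne).le) (by positivity)).trans ?_
    rw [Real.rpow_sub two_pos, Real.rpow_one, Real.rpow_def_of_pos two_pos, mul_div_left_comm,
      ← Real.exp_sub]
    refine mul_le_mul_of_nonneg_left (Real.exp_le_exp.2 ?_) two_pos.le
    have e1 : (n : ℝ) * (Real.log 2 * (h pA - (θ n).lA / n) - G / 2)
        = n * (h pA * Real.log 2 - G / 2) - Real.log 2 * (θ n).lA := by
      linear_combination -Real.log 2 * mul_div_cancel₀ (θ n).lA hn'.ne'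
    have hslog : Real.log (4 * (s * (1 - s)))
        = 2 * Real.log 2 + Real.log s + Real.log (1 - s) := by
      have h4 := tilt_sub 0 hs0 (by linarith : s < 1) 0 1
      simp only [tilt] at h4
      linarith
    -- The exponent of the ball intersection, with centres at distance at least `2 σ n`, is the tilt
    -- plus the cost of the wider radius.
    have e2 : -((p + δ) * n) * Real.log s - (n - (p + δ) * n) * Real.log (1 - s)
        + 2 * σ * n / 2 * Real.log (4 * (s * (1 - s))) = n * (tilt p s σ + δ * L) := by
      rw [hslog, tilt, hL]; ring
    rw [e1, e2]
    have : tilt p s σ + δ * L ≤ h pA * Real.log 2 - G / 2 := by linarith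
    linarith [mul_le_mul_of_nonneg_left this hn'.le]

end Commitment

end

theorem mainTheorem5 (p : unitInterval) (hp0 : 0 < (p : ℝ)) (hp : (p : ℝ) < 1 / 2) :
    Set.BijOn (Commitment.g p) (Set.Icc 0 p) (Set.Icc (2 * p) (Commitment.h p)) ∧
    (∀ pA pB : unitInterval,
      2 * (p : ℝ) ≤ Commitment.h pA → Commitment.h pA ≤ Commitment.h p →
      2 * Commitment.gInv p (Commitment.h pA) ≤ 1 / 2 →
      Commitment.Achievable (Commitment.bscModel p pA pB) (Commitment.rate p pA pB) ∧
      ∃ θ : ℕ → Commitment.Params,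
        (∀ n, (θ n).p = p ∧
          Commitment.bscAlice n pA ∈ (Commitment.usnc n (θ n)).alice ∧
          Commitment.bscBob n pB ∈ (Commitment.usnc n (θ n)).bob) ∧
        Filter.Tendsto (fun n => (θ n).εA) Filter.atTop (nhds 0) ∧
        Filter.Tendsto (fun n => (θ n).εB) Filter.atTop (nhds 0) ∧
        Filter.Tendsto (fun n => (θ n).lA / n) Filter.atTop (nhds (Commitment.h pA)) ∧
        Filter.Tendsto (fun n => (θ n).lB / n) Filter.atTop (nhds (Commitment.h pB)) ∧
        Commitment.Achievable (fun n => Commitment.usnc n (θ n)) (Commitment.rate p pA pB)) ∧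
    Commitment.rate p p p = Commitment.h p := by
  refine ⟨Commitment.bijOn_g hp0.le hp, fun pA pB h1 h2 h3 => ?_,
    Commitment.rate_self hp0.le hp⟩
  obtain ⟨εA, lA, hεA0, hlA0, hεA, hlA, hA⟩ := Commitment.exists_typical pA
  obtain ⟨εB, lB, hεB0, hlB0, hεB, hlB, hB⟩ := Commitment.exists_typical pB
  let θ : ℕ → Commitment.Params := fun n =>
    ⟨p, hp0, hp, εA n, lA n, εB n, lB n, hεA0 n, hlA0 n, hεB0 n, hlB0 n⟩
  have hach := Commitment.achievable_usnc (pB := pB) (θ := θ) hp h1 h2 h3 (fun _ => rfl)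
    hεA hεB hlA hlB
  have hmemA : ∀ n, Commitment.bscAlice n pA ∈ (Commitment.usnc n (θ n)).alice :=
    fun n x => Commitment.le_smoothMinEntropy_bsc pA x (hA n x)
  have hmemB : ∀ n, Commitment.bscBob n pB ∈ (Commitment.usnc n (θ n)).bob :=
    fun n => Commitment.le_smoothCondMinEntropy_bscBob pB (hB n)
  -- In the BSC model each dishonest party has a single channel, admissible in the UsNC model, so
  -- the same protocols work.
  exact ⟨hach.mono (fun _ => rfl) (fun n => Set.singleton_subset_iff.2 (hmemA n))
    (fun n => Set.singleton_subset_iff.2 (hmemB n)), θ, fun n => ⟨rfl, hmemA n, hmemB n⟩,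
    hεA, hεB, hlA, hlB, hach⟩
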